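/- Let $\gamma>0$ and $0<\alpha_0<1$. Let $\mathrm{GN}_\gamma(\mu)$ be the generalized Gaussian (Subbotin) distribution on $\mathbb R$ with density $$\frac1{C_\gamma}\exp\Bigl(-\frac{|x-\mu|^\gamma}{\gamma}\Bigr),\qquad C_\gamma=2\,\Gamma(1/\gamma)\,\gamma^{1/\gamma-1}.$$ For $\tfrac12<\beta<1$ and $0<r<1$ put $\varepsilon_n=n^{-\beta}$ and $\mu_n=(\gamma r\log n)^{1/\gamma}$, and consider the hypotheses $$H_0:\ X_i\overset{\text{i.i.d.}}{\sim}\mathrm{GN}_\gamma(0),\qquad H_1^{(n)}:\ X_i\overset{\text{i.i.d.}}{\sim}(1-\varepsilon_n)\,\mathrm{GN}_\gamma(0)+\varepsilon_n\,\mathrm{GN}_\gamma(\mu_n),\qquad 1\le i\le n.$$ Define $\rho^*_\gamma(\beta)$ for $\tfrac12<\beta<1$ as follows. If $\gamma>1$, $$\rho_\gamma^*(\beta)=\begin{cases}(2^{1/(\gamma-1)}-1)^{\gamma-1}\,(\beta-\tfrac12), & \tfrac12<\beta\le 1-2^{-\gamma/(\gamma-1)},\\[2pt] (1-(1-\beta)^{1/\gamma})^{\gamma},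 & 1-2^{-\gamma/(\gamma-1)}<\beta<1,\end{cases}$$ and if $0<\gamma\le1$, $\rho^*_\gamma(\beta)=2(\beta-\tfrac12)$. Let $p_i=P\{\mathrm{GN}_\gamma(0)>X_i\}$, let $p_{(1)}\le\dots\le p_{(n)}$ be the sorted $p$-values, and let $$\mathrm{HC}^*_n=\max_{1\le i\le\alpha_0 n}\frac{\sqrt n\,\bigl(i/n-p_{(i)}\bigr)}{\sqrt{p_{(i)}(1-p_{(i)})}}$$ be the higher criticism statistic. Say that critical values $h_n$ belong to levels $\alpha_n\to0$ tending to $0$ slowly enough if $P_{H_0}\{\mathrm{HC}^*_n>h_n\}\le\alpha_n$ for all $n$ and $h_n=\sqrt{2\log\log n}\,(1+o(1))$. Then $0<\rho^*_\gamma(\beta)<1$ for all $\beta\in(\tfrac12,1)$, and for all $\beta\in(\tfrac12,1)$ and $r\in(0,1)$ the following hold. 1. ($\rho^*_\gamma$ is the optimal detection boundary.) If $r>\rho^*_\gamma(\beta)$, the sum of the type I and type II errors of the likelihood ratio test (which rejects $H_0$ when the likelihood ratio of $H_1^{(n)}$ to $H_0$ exceeds $1$) tends to $0$ as $n\to\infty$.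 If $r<\rho^*_\gamma(\beta)$, this sum tends to $1$, and so does the infimum of the sum of the two errors over all tests. 2. ($\rho^*_\gamma$ is the detection boundary of higher criticism.) For all levels $\alpha_n\to 0$ tending to $0$ slowly enough, with critical values $h_n$: if $r>\rho^*_\gamma(\beta)$, then $P_{H_1^{(n)}}\{\mathrm{HC}^*_n>h_n\}\to1$; if $r<\rho^*_\gamma(\beta)$, then $P_{H_1^{(n)}}\{\mathrm{HC}^*_n>h_n\}\to0$. -/

import Mathlib

open MeasureTheory Filter Topology
open scoped ENNReal

noncomputable section

namespace HigherCriticism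

/-! ### The generalized Gaussian (Subbotin) mixture model -/

/-- The normalizing constant `C_γ = 2 Γ(1/γ) γ^(1/γ - 1)`. -/
def gnConst (γ : ℝ) : ℝ := 2 * Real.Gamma (1 / γ) * γ ^ (1 / γ - 1)

/-- The Lebesgue density of `GN_γ(μ)`. -/
def gnDensity (γ μ x : ℝ) : ℝ := (1 / gnConst γ) * Real.exp (-(|x - μ| ^ γ / γ))

/-- The generalized Gaussian distribution `GN_γ(μ)` on the line. -/
def gnMeasure (γ μ : ℝ) : Measure ℝ :=
  volume.withDensity fun x => ENNReal.ofReal (gnDensity γ μ x)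

/-- The mixing fraction `ε_n = n^(-β)`. -/
def sparsity (β : ℝ) (n : ℕ) : ℝ := (n : ℝ) ^ (-β)

/-- The amplitude `μ_{γ,n} = (γ r log n)^(1/γ)`. -/
def amplitude (γ r : ℝ) (n : ℕ) : ℝ := (γ * r * Real.log n) ^ (1 / γ)

/-- The mixture `(1 - ε_n) GN_γ(0) + ε_n GN_γ(μ_{γ,n})`. -/
def mixtureMeasure (γ β r : ℝ) (n : ℕ) : Measure ℝ :=
  ENNReal.ofReal (1 - sparsity β n) • gnMeasure γ 0 +
    ENNReal.ofReal (sparsity β n) • gnMeasure γ (amplitude γ r n)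

/-- The law of the sample `(X_1, …, X_n)` under `H_0`: i.i.d. `GN_γ(0)`. -/
def nullLaw (γ : ℝ) (n : ℕ) : Measure (Fin n → ℝ) :=
  Measure.pi fun _ => gnMeasure γ 0

/-- The law of the sample `(X_1, …, X_n)` under `H_1^(n)`: i.i.d. from the mixture. -/
def altLaw (γ β r : ℝ) (n : ℕ) : Measure (Fin n → ℝ) :=
  Measure.pi fun _ => mixtureMeasure γ β r n

/-! ### The likelihood ratio test and the optimal detection boundary -/

/-- The sum of the type I and type II errors of the test that rejects the hypothesis `P`
(in favour of `Q`) on the event `A`. -/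
def errorSum {Ω : Type*} [MeasurableSpace Ω] (P Q : Measure Ω) (A : Set Ω) : ℝ≥0∞ :=
  P A + Q Aᶜ

/-- The infimum of the sum of errors over all tests. -/
def minErrorSum {Ω : Type*} [MeasurableSpace Ω] (P Q : Measure Ω) : ℝ≥0∞ :=
  ⨅ (A : Set Ω) (_ : MeasurableSet A), errorSum P Q A

/-- The likelihood ratio of `H_1^(n)` against `H_0` at the sample `x`. -/
def likelihoodRatio (γ β r : ℝ) (n : ℕ) (x : Fin n → ℝ) : ℝ :=
  ∏ i, ((1 - sparsity β n) * gnDensity γ 0 (x i) +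
      sparsity β n * gnDensity γ (amplitude γ r n) (x i)) / gnDensity γ 0 (x i)

/-- The rejection region of the likelihood ratio test: `H_0` is rejected if the observed sample
is more likely under `H_1^(n)`. -/
def lrtRegion (γ β r : ℝ) (n : ℕ) : Set (Fin n → ℝ) :=
  {x | 1 < likelihoodRatio γ β r n x}

/-- `H_0` and `H_1^(n)` separate asymptotically: the sum of the two errors of the likelihood
ratio test tends to `0`. -/
def Separate (γ β r : ℝ) : Prop :=
  Tendsto (fun n => errorSum (nullLaw γ n) (altLaw γ β r n) (lrtRegion γ β r n)) atTop (𝓝 0)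

/-- `H_0` and `H_1^(n)` merge asymptotically: the sum of the two errors of the likelihood ratio
test tends to `1`, and no other tests do better in the limit. -/
def Merge (γ β r : ℝ) : Prop :=
  Tendsto (fun n => errorSum (nullLaw γ n) (altLaw γ β r n) (lrtRegion γ β r n)) atTop (𝓝 1) ∧
    Tendsto (fun n => minErrorSum (nullLaw γ n) (altLaw γ β r n)) atTop (𝓝 1)

/-- `ρ` is the optimal (efficient) detection boundary in the region `1/2 < β < 1`, `0 < r < 1`.
The values of `ρ` on `(1/2, 1)` are required to lie in the range of `r`. -/
def IsOptimalBoundary (γ : ℝ) (ρ : ℝ → ℝ) : Prop :=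
  ∀ β ∈ Set.Ioo (1 / 2 : ℝ) 1, ρ β ∈ Set.Ioo (0 : ℝ) 1 ∧
    ∀ r ∈ Set.Ioo (0 : ℝ) 1,
      (ρ β < r → Separate γ β r) ∧ (r < ρ β → Merge γ β r)

/-! ### Higher criticism and its detection boundary -/

/-- The p-value `P{GN_γ(0) > x}`. -/
def pValue (γ x : ℝ) : ℝ := (gnMeasure γ 0).real (Set.Ioi x)

/-- The values of `p` in increasing order: `sorted p i` is the order statistic `p_(i+1)`. -/
def sorted {n : ℕ} (p : Fin n → ℝ) : Fin n → ℝ := p ∘ Tuple.sort p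

/-- The higher criticism statistic
`HC*_n = max_{1 ≤ i ≤ α₀ n} √n (i/n - p_(i)) / √(p_(i) (1 - p_(i)))` of `n` p-values;
here `i` is `k + 1` for `k : Fin n`. -/
def hcStat (α₀ : ℝ) {n : ℕ} (p : Fin n → ℝ) : ℝ :=
  ⨆ k : {k : Fin n // ((k : ℕ) + 1 : ℝ) ≤ α₀ * n},
    √n * ((((k : Fin n) : ℕ) + 1 : ℝ) / n - sorted p k) /
      √(sorted p k * (1 - sorted p k))

/-- Higher criticism applied to the `GN_γ(0)` p-values of the sample rejects `H_0` when it
exceeds the critical value `h`. -/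
def hcRegion (γ α₀ : ℝ) (n : ℕ) (h : ℝ) : Set (Fin n → ℝ) :=
  {x | h < hcStat α₀ fun i => pValue γ (x i)}

/-- `h n` are critical values of the level-`α n` higher criticism tests, where `α n → 0` slowly
enough: `h n = √(2 log log n) (1 + o(1))`. -/
structure IsSlowCriticalSeq (γ α₀ : ℝ) (α h : ℕ → ℝ) : Prop where
  level_le : ∀ n, (nullLaw γ n).real (hcRegion γ α₀ n (h n)) ≤ α n
  level_tendsto : Tendsto α atTop (𝓝 0)
  slow : Tendsto (fun n : ℕ => h n / √(2 * Real.log (Real.log n))) atTop (𝓝 1)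

/-- `ρ` is the detection boundary of higher criticism in the region `1/2 < β < 1`, `0 < r < 1`:
for levels tending to `0` slowly enough the power tends to `1` for `r > ρ(β)`, and to `0` for
`r < ρ(β)`. -/
def IsHCBoundary (γ α₀ : ℝ) (ρ : ℝ → ℝ) : Prop :=
  ∀ β ∈ Set.Ioo (1 / 2 : ℝ) 1, ρ β ∈ Set.Ioo (0 : ℝ) 1 ∧
    ∀ r ∈ Set.Ioo (0 : ℝ) 1, ∀ α h : ℕ → ℝ, IsSlowCriticalSeq γ α₀ α h →
      (ρ β < r →
        Tendsto (fun n => (altLaw γ β r n).real (hcRegion γ α₀ n (h n))) atTop (𝓝 1)) ∧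
      (r < ρ β →
        Tendsto (fun n => (altLaw γ β r n).real (hcRegion γ α₀ n (h n))) atTop (𝓝 0))

/-- The function `ρ*_γ`. -/
def rhoStar (γ β : ℝ) : ℝ :=
  if 1 < γ then
    if β ≤ 1 - 2 ^ (-(γ / (γ - 1))) then
      (2 ^ (1 / (γ - 1)) - 1) ^ (γ - 1) * (β - 1 / 2)
    else (1 - (1 - β) ^ (1 / γ)) ^ γ
  else 2 * (β - 1 / 2)

end HigherCriticism

end

namespace HigherCriticism

/-! ### The generalized Gaussian distribution -/

/-! Everything is measured in powers of n. Put l = (γ log n)^(1/γ) and ρ = r^(1/γ), so the signals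
sit at ρl. The null tail beyond sl is n^(-s^γ + o(1)). For s > ρ, about n^(1 - β - (s - ρ)^γ)
signals are therefore expected above sl, against a null standard deviation of order n^((1 - s^γ)/2).
The exponent of signal over noise is G(s) = s^γ/2 + 1/2 - β - |s - ρ|^γ, and the whole theorem is
governed by the sign of G on [0, 1].

If G(s) > 0 for some ρ < s < 1, counting the observations above sl already separates the hypotheses:
Chebyshev's inequality controls both errors, and the likelihood ratio test does no worse. Higher
criticism inherits the power, since one term of its maximum is at least the standardized count, and
the count test asks for log n standard deviations while h n is only of order √(log log n)
(`mem_hcRegion_of_mem_exceedanceRegion`).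

If G < 0 on [0, 1], the Hellinger affinity of one observation is 1 - o(1/n)
(`Merge.of_exponent_neg`). Its n-th power tends to 1, which forces the error sum to 1 for every
test. Up to x = l a second-order expansion of the square root reduces this to the size of g₁²/g₀,
whose exponent at x = sl is s^γ - 2|s - ρ|^γ; beyond l a first-order bound suffices. Higher
criticism then fails like any test of vanishing level.

It remains to see that `rhoStar` is where max G changes sign. For γ > 1 this is weighted convexity
of x^γ: the first branch has its maximizer inside [0, 1], the second has it at s = 1. For γ ≤ 1
subadditivity makes s = ρ optimal. -/

theorem gnConst_pos {γ : ℝ} (hγ : 0 < γ) : 0 < gnConst γ := by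
  have := Real.Gamma_pos_of_pos (one_div_pos.2 hγ)
  have := Real.rpow_pos_of_pos hγ (1 / γ - 1)
  unfold gnConst
  positivity

theorem gnDensity_pos {γ : ℝ} (hγ : 0 < γ) (μ x : ℝ) : 0 < gnDensity γ μ x :=
  mul_pos (one_div_pos.2 (gnConst_pos hγ)) (Real.exp_pos _)

theorem continuous_gnDensity {γ : ℝ} (hγ : 0 < γ) (μ : ℝ) : Continuous (gnDensity γ μ) := by
  unfold gnDensity
  have : Continuous fun x : ℝ => |x - μ| ^ γ :=
    (continuous_abs.comp (continuous_id.sub continuous_const)).rpow_const fun _ => Or.inr hγ.le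
  fun_prop

theorem integrable_exp_neg_abs_rpow {γ b : ℝ} (hγ : 0 < γ) (hb : 0 < b) :
    Integrable fun x : ℝ => Real.exp (-(b * |x| ^ γ)) := by
  have h : IntegrableOn (fun x : ℝ => Real.exp (-(b * |x| ^ γ))) (Set.Ioi 0) := by
    have h := integrableOn_rpow_mul_exp_neg_mul_rpow (p := γ) (s := 0) (by norm_num) hγ hb
    refine h.congr_fun (fun x hx => ?_) measurableSet_Ioi
    simp [abs_of_pos (Set.mem_Ioi.1 hx)]
  have h' : IntegrableOn (fun x : ℝ => Real.exp (-(b * |x| ^ γ))) (Set.Iic 0) := by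
    rw [integrableOn_Iic_iff_integrableOn_Iio]
    have h0 : IntegrableOn (fun x : ℝ => Real.exp (-(b * |x| ^ γ))) (Set.Ioi (-0)) := by
      rwa [neg_zero]
    simpa using h0.comp_neg_Iio
  rw [← integrableOn_univ, ← Set.Iic_union_Ioi (a := (0 : ℝ))]
  exact h'.union h

theorem integral_exp_neg_abs_rpow_div {γ : ℝ} (hγ : 0 < γ) :
    ∫ x : ℝ, Real.exp (-(|x| ^ γ / γ)) = gnConst γ := by
  have h1 := integral_exp_neg_mul_rpow hγ (inv_pos.2 hγ)
  rw [integral_comp_abs (f := fun x : ℝ => Real.exp (-(x ^ γ / γ)))]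
  have h2 : ∀ x : ℝ, Real.exp (-(x ^ γ / γ)) = Real.exp (-γ⁻¹ * x ^ γ) := fun x => by
    congr 1; ring
  simp_rw [h2, h1]
  rw [Real.Gamma_add_one (by positivity), Real.inv_rpow hγ.le, ← Real.rpow_neg hγ.le, neg_div, neg_neg, gnConst,
    Real.rpow_sub_one hγ.ne']
  ring

theorem integrable_gnDensity {γ : ℝ} (hγ : 0 < γ) (μ : ℝ) : Integrable (gnDensity γ μ) := by
  unfold gnDensity
  refine Integrable.const_mul ?_ _
  have := (integrable_exp_neg_abs_rpow hγ (inv_pos.2 hγ)).comp_sub_right μ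
  refine this.congr (Eventually.of_forall fun x => ?_)
  simp only
  congr 1; ring

theorem integral_gnDensity {γ : ℝ} (hγ : 0 < γ) (μ : ℝ) : ∫ x, gnDensity γ μ x = 1 := by
  unfold gnDensity
  rw [integral_const_mul, integral_sub_right_eq_self (fun x : ℝ => Real.exp (-(|x| ^ γ / γ))) μ,
    integral_exp_neg_abs_rpow_div hγ]
  exact one_div_mul_cancel (gnConst_pos hγ).ne'

theorem gnMeasure_apply {γ : ℝ} (hγ : 0 < γ) (μ : ℝ) {s : Set ℝ} (hs : MeasurableSet s) :
    gnMeasure γ μ s = ENNReal.ofReal (∫ x in s, gnDensity γ μ x) := by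
  rw [gnMeasure, withDensity_apply _ hs, ofReal_integral_eq_lintegral_ofReal
    (integrable_gnDensity hγ μ).integrableOn
    (Eventually.of_forall fun x => (gnDensity_pos hγ μ x).le)]

theorem gnMeasure_real {γ : ℝ} (hγ : 0 < γ) (μ : ℝ) {s : Set ℝ} (hs : MeasurableSet s) :
    (gnMeasure γ μ).real s = ∫ x in s, gnDensity γ μ x := by
  rw [measureReal_def, gnMeasure_apply hγ μ hs, ENNReal.toReal_ofReal]
  exact setIntegral_nonneg hs fun x _ => (gnDensity_pos hγ μ x).le

theorem isProbabilityMeasure_gnMeasure {γ : ℝ} (hγ : 0 < γ) (μ : ℝ) :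
    IsProbabilityMeasure (gnMeasure γ μ) :=
  ⟨by rw [gnMeasure_apply hγ μ .univ, setIntegral_univ, integral_gnDensity hγ, ENNReal.ofReal_one]⟩

theorem gnMeasure_real_Ioi {γ : ℝ} (hγ : 0 < γ) (μ t : ℝ) :
    (gnMeasure γ μ).real (Set.Ioi t) = pValue γ (t - μ) := by
  rw [pValue, gnMeasure_real hγ _ measurableSet_Ioi, gnMeasure_real hγ _ measurableSet_Ioi]
  have h := (measurePreserving_sub_right volume μ).setIntegral_preimage_emb
    (measurableEmbedding_subRight μ) (gnDensity γ 0) (Set.Ioi (t - μ))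
  rw [Set.preimage_sub_const_Ioi, sub_add_cancel] at h
  simpa [gnDensity] using h

theorem pValue_antitone {γ : ℝ} (hγ : 0 < γ) : Antitone (pValue γ) := fun x y hxy => by
  have := isProbabilityMeasure_gnMeasure hγ 0
  exact measureReal_mono (Set.Ioi_subset_Ioi hxy)

theorem gnMeasure_real_pos {γ : ℝ} (hγ : 0 < γ) (μ : ℝ) {s : Set ℝ}
    (h : volume s ≠ 0) : 0 < (gnMeasure γ μ).real s := by
  have := isProbabilityMeasure_gnMeasure hγ μ
  rw [measureReal_def, ENNReal.toReal_pos_iff]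
  refine ⟨pos_iff_ne_zero.2 fun h0 => h ?_, measure_lt_top _ _⟩
  have hm : Measurable fun x => ENNReal.ofReal (gnDensity γ μ x) :=
    ENNReal.measurable_ofReal.comp (continuous_gnDensity hγ μ).measurable
  rw [gnMeasure, withDensity_apply_eq_zero hm] at h0
  convert h0
  rw [Set.inter_eq_right.2]
  intro x _
  simpa using gnDensity_pos hγ μ x

theorem pValue_pos {γ : ℝ} (hγ : 0 < γ) (x : ℝ) : 0 < pValue γ x :=
  gnMeasure_real_pos hγ 0 (by simp)

theorem pValue_lt_one {γ : ℝ} (hγ : 0 < γ) (x : ℝ) : pValue γ x < 1 := by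
  have := isProbabilityMeasure_gnMeasure hγ 0
  have h := gnMeasure_real_pos hγ 0 (s := Set.Iic x) (by simp)
  rw [← Set.compl_Ioi, probReal_compl_eq_one_sub measurableSet_Ioi] at h
  exact sub_pos.1 h

/-- A fraction η of the exponent is kept to make the integral converge and the rest is bounded by
its value at a. This is cruder than Mills-ratio asymptotics but treats all γ > 0 alike. -/
theorem pValue_le_exp {γ : ℝ} (hγ : 0 < γ) {η : ℝ} (hη : 0 < η) (hη1 : η < 1) :
    ∃ K, 0 < K ∧ ∀ a, 0 ≤ a → pValue γ a ≤ K * Real.exp (-((1 - η) * (a ^ γ / γ))) := by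
  set f : ℝ → ℝ := fun x => 1 / gnConst γ * Real.exp (-(η / γ * |x| ^ γ)) with hf
  have hC := gnConst_pos hγ
  have hint : Integrable f := (integrable_exp_neg_abs_rpow hγ (div_pos hη hγ)).const_mul _
  have hf0 : ∀ x, 0 ≤ f x := fun x => by positivity
  refine ⟨(∫ x, f x) + 1, by linarith [integral_nonneg (μ := volume) (f := f) hf0], fun a ha => ?_⟩
  rw [pValue, gnMeasure_real hγ _ measurableSet_Ioi]
  calc ∫ x in Set.Ioi a, gnDensity γ 0 x
      ≤ ∫ x in Set.Ioi a, f x * Real.exp (-((1 - η) * (a ^ γ / γ))) := by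
        refine setIntegral_mono_on (integrable_gnDensity hγ 0).integrableOn
          (hint.mul_const _).integrableOn measurableSet_Ioi fun x hx => ?_
        have hx : a < x := hx
        rw [gnDensity, hf, mul_assoc, ← Real.exp_add, sub_zero]
        refine mul_le_mul_of_nonneg_left (Real.exp_le_exp.2 ?_) (by positivity)
        rw [abs_of_pos (ha.trans_lt hx)]
        have h1 : a ^ γ ≤ x ^ γ := Real.rpow_le_rpow ha hx.le hγ.le
        have h2 : (1 - η) * (a ^ γ / γ) ≤ (1 - η) * (x ^ γ / γ) := by
          have : 0 ≤ 1 - η := by linarith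
          gcongr
        have : x ^ γ / γ = η / γ * x ^ γ + (1 - η) * (x ^ γ / γ) := by ring
        linarith
    _ = (∫ x in Set.Ioi a, f x) * Real.exp (-((1 - η) * (a ^ γ / γ))) := integral_mul_const _ _
    _ ≤ _ := by
        gcongr
        linarith [setIntegral_le_integral (s := Set.Ioi a) hint (Eventually.of_forall hf0)]

/-- The tail contains a rectangle of width ηa, whose height is the density at its right end. -/
theorem le_pValue {γ : ℝ} (hγ : 0 < γ) {η a : ℝ} (hη : 0 < η) (ha : 0 ≤ a) :
    η * a / gnConst γ * Real.exp (-(((1 + η) * a) ^ γ / γ)) ≤ pValue γ a := by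
  have hC := gnConst_pos hγ
  rw [pValue, gnMeasure_real hγ _ measurableSet_Ioi]
  have hle : a ≤ (1 + η) * a := by nlinarith
  calc η * a / gnConst γ * Real.exp (-(((1 + η) * a) ^ γ / γ))
      = ∫ _ in Set.Ioc a ((1 + η) * a),
          1 / gnConst γ * Real.exp (-(((1 + η) * a) ^ γ / γ)) := by
        rw [setIntegral_const, measureReal_def, Real.volume_Ioc,
          ENNReal.toReal_ofReal (by linarith), smul_eq_mul]
        ring
    _ ≤ ∫ x in Set.Ioc a ((1 + η) * a), gnDensity γ 0 x := by
        refine setIntegral_mono_on (integrableOn_const (by simp)) (integrable_gnDensity hγ 0).integrableOn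
          measurableSet_Ioc fun x hx => ?_
        rw [gnDensity, sub_zero, abs_of_pos (ha.trans_lt hx.1)]
        have : x ^ γ ≤ ((1 + η) * a) ^ γ := Real.rpow_le_rpow (ha.trans hx.1.le) hx.2 hγ.le
        gcongr
    _ ≤ _ := setIntegral_mono_set (integrable_gnDensity hγ 0).integrableOn
        (Eventually.of_forall fun x => (gnDensity_pos hγ 0 x).le)
        Set.Ioc_subset_Ioi_self.eventuallyLE

/-! ### Tail probabilities at the scale `(γ log n)^(1/γ)` -/

/-- The scale `(γ log n)^(1/γ)` of the maximum of `n` standard generalized Gaussians. -/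
noncomputable def scale (γ : ℝ) (n : ℕ) : ℝ := (γ * Real.log n) ^ (1 / γ)

theorem scale_nonneg {γ : ℝ} (hγ : 0 < γ) (n : ℕ) : 0 ≤ scale γ n :=
  Real.rpow_nonneg (mul_nonneg hγ.le (Real.log_natCast_nonneg n)) _

theorem amplitude_eq {γ r : ℝ} (hγ : 0 < γ) (hr : 0 ≤ r) (n : ℕ) :
    amplitude γ r n = scale γ n * r ^ (1 / γ) := by
  rw [amplitude, scale, ← Real.mul_rpow (mul_nonneg hγ.le (Real.log_natCast_nonneg n)) hr]
  ring_nf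

theorem scale_mul_rpow_div {γ v : ℝ} (hγ : 0 < γ) (hv : 0 ≤ v) (n : ℕ) :
    (scale γ n * v) ^ γ / γ = v ^ γ * Real.log n := by
  have h := mul_nonneg hγ.le (Real.log_natCast_nonneg n)
  rw [Real.mul_rpow (scale_nonneg hγ n) hv, scale, ← Real.rpow_mul h, one_div_mul_cancel hγ.ne',
    Real.rpow_one]
  field_simp

theorem tendsto_scale {γ : ℝ} (hγ : 0 < γ) : Tendsto (scale γ) atTop atTop :=
  (tendsto_rpow_atTop (one_div_pos.2 hγ)).comp
    ((Real.tendsto_log_atTop.comp tendsto_natCast_atTop_atTop).const_mul_atTop hγ)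

theorem exp_neg_mul_log {n : ℕ} (hn : 0 < n) (c : ℝ) :
    Real.exp (-(c * Real.log n)) = (n : ℝ) ^ (-c) := by
  rw [Real.rpow_def_of_pos (by exact_mod_cast hn)]
  ring_nf

theorem tendsto_natCast_rpow_neg {c : ℝ} (hc : 0 < c) :
    Tendsto (fun n : ℕ => (n : ℝ) ^ (-c)) atTop (𝓝 0) :=
  (tendsto_rpow_neg_atTop hc).comp tendsto_natCast_atTop_atTop

theorem eventually_le_natCast_rpow (K : ℝ) {c : ℝ} (hc : 0 < c) :
    ∀ᶠ n : ℕ in atTop, K ≤ (n : ℝ) ^ c :=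
  ((tendsto_rpow_atTop hc).comp tendsto_natCast_atTop_atTop).eventually_ge_atTop K

theorem eventually_pValue_le {γ v δ : ℝ} (hγ : 0 < γ) (hv : 0 < v) (hδ : 0 < δ) :
    ∀ᶠ n : ℕ in atTop, pValue γ (scale γ n * v) ≤ (n : ℝ) ^ (-v ^ γ + δ) := by
  have hvγ := Real.rpow_pos_of_pos hv γ
  -- The loss η v^γ in the exponent costs less than δ/2; the other δ/2 absorbs the constant K.
  obtain ⟨η, hη, hη'⟩ : ∃ η, 0 < η ∧ η < min 1 (δ / (2 * v ^ γ)) := exists_between (by positivity)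
  have hη1 := hη'.trans_le (min_le_left _ _)
  have hη2 : η * v ^ γ < δ / 2 := by
    have := hη'.trans_le (min_le_right _ _)
    rw [lt_div_iff₀ (by positivity)] at this
    linarith
  obtain ⟨K, hK, hKle⟩ := pValue_le_exp hγ hη hη1
  filter_upwards [eventually_le_natCast_rpow K (half_pos hδ), eventually_gt_atTop 0] with n hn hn0
  have h1 : (1 : ℝ) ≤ n := by exact_mod_cast hn0
  calc pValue γ (scale γ n * v)
      ≤ K * Real.exp (-((1 - η) * ((scale γ n * v) ^ γ / γ))) :=
        hKle _ (mul_nonneg (scale_nonneg hγ n) hv.le)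
    _ = K * (n : ℝ) ^ (-((1 - η) * v ^ γ)) := by
        rw [scale_mul_rpow_div hγ hv.le, ← mul_assoc, exp_neg_mul_log hn0]
    _ ≤ (n : ℝ) ^ (δ / 2) * (n : ℝ) ^ (-((1 - η) * v ^ γ)) := by gcongr
    _ = (n : ℝ) ^ (δ / 2 + -((1 - η) * v ^ γ)) := by rw [Real.rpow_add (by linarith)]
    _ ≤ _ := Real.rpow_le_rpow_of_exponent_le h1 (by linarith)

theorem eventually_le_pValue {γ v δ : ℝ} (hγ : 0 < γ) (hv : 0 < v) (hδ : 0 < δ) :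
    ∀ᶠ n : ℕ in atTop, (n : ℝ) ^ (-v ^ γ - δ) ≤ pValue γ (scale γ n * v) := by
  have hC := gnConst_pos hγ
  obtain ⟨η, hη, hη'⟩ : ∃ η > 0, ((1 + η) * v) ^ γ < v ^ γ + δ := by
    have hc : Tendsto (fun η : ℝ => ((1 + η) * v) ^ γ) (𝓝[>] 0) (𝓝 (((1 + 0) * v) ^ γ)) := by
      refine Tendsto.mono_left (Continuous.tendsto ?_ 0) nhdsWithin_le_nhds
      exact (by fun_prop : Continuous fun η : ℝ => (1 + η) * v).rpow_const fun _ => Or.inr hγ.le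
    have := hc.eventually_lt_const (u := v ^ γ + δ) (by simpa using hδ)
    obtain ⟨η, h1, h2⟩ := (this.and self_mem_nhdsWithin).exists
    exact ⟨η, h2, h1⟩
  have hlim : ∀ᶠ n : ℕ in atTop, 1 ≤ η * (scale γ n * v) / gnConst γ := by
    have : Tendsto (fun n : ℕ => η * v / gnConst γ * scale γ n) atTop atTop :=
      (tendsto_scale hγ).const_mul_atTop (by positivity)
    filter_upwards [this.eventually_ge_atTop 1] with n hn
    exact hn.trans_eq (by ring)
  filter_upwards [hlim, eventually_gt_atTop 0] with n hn hn0
  have h1 : (1 : ℝ) ≤ n := by exact_mod_cast hn0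
  calc (n : ℝ) ^ (-v ^ γ - δ) ≤ (n : ℝ) ^ (-((1 + η) * v) ^ γ) :=
        Real.rpow_le_rpow_of_exponent_le h1 (by linarith)
    _ = 1 * Real.exp (-(((1 + η) * (scale γ n * v)) ^ γ / γ)) := by
        rw [mul_left_comm, scale_mul_rpow_div hγ (by positivity), exp_neg_mul_log hn0, one_mul]
    _ ≤ η * (scale γ n * v) / gnConst γ *
          Real.exp (-(((1 + η) * (scale γ n * v)) ^ γ / γ)) := by gcongr
    _ ≤ _ := le_pValue hγ hη (mul_nonneg (scale_nonneg hγ n) hv.le)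

/-! ### Counting exceedances in an i.i.d. sample -/

section Count

open Classical in
/-- The number of coordinates of `x` that lie in `s`. -/
noncomputable def count {α : Type*} {n : ℕ} (s : Set α) (x : Fin n → α) : ℕ :=
  (Finset.univ.filter fun i => x i ∈ s).card

variable {α : Type*} [MeasurableSpace α]

theorem count_eq_sum {α : Type*} {n : ℕ} (s : Set α) (x : Fin n → α) :
    (count s x : ℝ) = ∑ i, s.indicator (fun _ => (1 : ℝ)) (x i) := by
  classical
  simp [count, Set.indicator_apply]

theorem measurable_count {n : ℕ} {s : Set α} (hs : MeasurableSet s) :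
    Measurable fun x : Fin n → α => (count s x : ℝ) := by
  simp_rw [count_eq_sum]
  exact Finset.measurable_sum _ fun i _ =>
    (measurable_const.indicator hs).comp (measurable_pi_apply i)

variable (P : Measure α) [IsProbabilityMeasure P]

theorem integral_count (n : ℕ) {s : Set α} (hs : MeasurableSet s) :
    ∫ x, (count s x : ℝ) ∂(Measure.pi fun _ : Fin n => P) = n * P.real s := by
  simp_rw [count_eq_sum]
  have hint : Integrable (s.indicator fun _ => (1 : ℝ)) P := (integrable_const 1).indicator hs
  rw [integral_finsetSum _ fun i _ =>
    integrable_comp_eval (μ := fun _ : Fin n => P) (i := i) hint]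
  have h : ∀ i : Fin n, ∫ x : Fin n → α, s.indicator (fun _ => (1 : ℝ)) (x i)
      ∂(Measure.pi fun _ : Fin n => P) = P.real s := fun i => by
    rw [integral_comp_eval (μ := fun _ : Fin n => P) (i := i) hint.aestronglyMeasurable,
      integral_indicator_const _ hs]
    simp
  simp [h]

/-- Chebyshev's inequality for the number of exceedances. -/
theorem measure_count_sub_ge (n : ℕ) {s : Set α} (hs : MeasurableSet s) {c : ℝ} (hc : 0 < c) :
    (Measure.pi fun _ : Fin n => P).real {x | c ≤ |(count s x : ℝ) - n * P.real s|} ≤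
      n * P.real s / c ^ 2 := by
  have hmem : MemLp (s.indicator fun _ => (1 : ℝ)) 2 P := (memLp_const 1).indicator hs
  have hsum : (fun x : Fin n → α => (count s x : ℝ)) =
      ∑ i : Fin n, fun x => s.indicator (fun _ => (1 : ℝ)) (x i) := by
    ext x
    simp [count_eq_sum]
  have hmemc : MemLp (fun x : Fin n → α => (count s x : ℝ)) 2
      (Measure.pi fun _ : Fin n => P) := by
    rw [hsum]
    exact memLp_finsetSum' _ fun i _ => hmem.comp_measurePreserving (measurePreserving_eval _ i)
  have hvar : ProbabilityTheory.variance (fun x : Fin n → α => (count s x : ℝ))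
      (Measure.pi fun _ : Fin n => P) ≤ n * P.real s := by
    rw [hsum, ProbabilityTheory.variance_sum_pi (fun _ => hmem)]
    have h1 : ProbabilityTheory.variance (s.indicator fun _ => (1 : ℝ)) P ≤ P.real s := by
      refine (ProbabilityTheory.variance_le_expectation_sq hmem.aestronglyMeasurable).trans_eq ?_
      have : (s.indicator fun _ => (1 : ℝ)) ^ 2 = s.indicator fun _ => (1 : ℝ) := by
        ext x
        by_cases h : x ∈ s <;> simp [h]
      rw [this, integral_indicator_const _ hs]
      simp
    simpa using mul_le_mul_of_nonneg_left h1 n.cast_nonneg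
  have h := ProbabilityTheory.meas_ge_le_variance_div_sq hmemc hc
  rw [integral_count P n hs] at h
  have h' := ENNReal.toReal_mono ENNReal.ofReal_ne_top h
  rw [ENNReal.toReal_ofReal (div_nonneg (ProbabilityTheory.variance_nonneg _ _) (sq_nonneg _))]
    at h'
  exact h'.trans (by gcongr)

/-- Markov's inequality for the number of exceedances. -/
theorem measure_count_gt (n : ℕ) {s : Set α} (hs : MeasurableSet s) {c : ℝ} (hc : 0 < c) :
    (Measure.pi fun _ : Fin n => P).real {x | c < (count s x : ℝ)} ≤ n * P.real s / c := by
  have hint : Integrable (fun x : Fin n → α => (count s x : ℝ))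
      (Measure.pi fun _ : Fin n => P) := by
    simp_rw [count_eq_sum]
    exact integrable_finsetSum _ fun i _ => integrable_comp_eval (μ := fun _ : Fin n => P)
      ((integrable_const 1).indicator hs)
  have h := mul_meas_ge_le_integral_of_nonneg (Eventually.of_forall fun x => by positivity) hint c
  rw [integral_count P n hs] at h
  rw [le_div_iff₀ hc, mul_comm]
  refine le_trans (mul_le_mul_of_nonneg_left (measureReal_mono fun x hx => ?_) hc.le) h
  exact (show c < (count s x : ℝ) from hx).le

end Count

/-! ### Likelihood ratio tests -/

section LikelihoodRatio

variable {Ω : Type*} [MeasurableSpace Ω]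

/-- Checked on rectangles, where the indicator of the box factorizes and independence of the
coordinates splits the integral. -/
theorem pi_withDensity {n : ℕ} (P : Measure Ω) [IsProbabilityMeasure P] {f : Ω → ℝ≥0∞}
    (hf : Measurable f) [IsProbabilityMeasure (P.withDensity f)] :
    (Measure.pi fun _ : Fin n => P.withDensity f) =
      (Measure.pi fun _ : Fin n => P).withDensity fun x => ∏ i, f (x i) := by
  refine Measure.pi_eq fun s hs => ?_
  rw [withDensity_apply _ (MeasurableSet.univ_pi hs), ← lintegral_indicator (MeasurableSet.univ_pi hs)]
  have h1 : ((Set.univ.pi s).indicator fun x : Fin n → Ω => ∏ i, f (x i)) =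
      fun x => ∏ i, (s i).indicator f (x i) := by
    ext x
    by_cases hx : x ∈ Set.univ.pi s
    · rw [Set.indicator_of_mem hx]
      exact Finset.prod_congr rfl fun i _ => (Set.indicator_of_mem (hx i trivial) f).symm
    · rw [Set.indicator_of_notMem hx]
      obtain ⟨i, hi⟩ : ∃ i, x i ∉ s i := by simpa using hx
      exact (Finset.prod_eq_zero (Finset.mem_univ i) (Set.indicator_of_notMem hi f)).symm
  have hm : ∀ i, Measurable ((s i).indicator f) := fun i => hf.indicator (hs i)
  rw [h1, ProbabilityTheory.lintegral_prod_eq_prod_lintegral_of_indepFun Finset.univ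
    (fun i (x : Fin n → Ω) => (s i).indicator f (x i))
    (ProbabilityTheory.iIndepFun_pi fun i => (hm i).aemeasurable)
    fun i => (hm i).comp (measurable_pi_apply i)]
  refine Finset.prod_congr rfl fun i _ => ?_
  rw [withDensity_apply _ (hs i), ← lintegral_indicator (hs i),
    ← (measurePreserving_eval (fun _ : Fin n => P) i).map_eq,
    lintegral_map (hm i) (measurable_pi_apply i)]
  simp [(measurePreserving_eval (fun _ : Fin n => P) i).map_eq]

variable (P : Measure Ω) {L : Ω → ℝ}

theorem errorSum_withDensity {A : Set Ω} (hA : MeasurableSet A) :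
    errorSum P (P.withDensity fun x => ENNReal.ofReal (L x)) A =
      ∫⁻ x, A.indicator 1 x + Aᶜ.indicator (fun x => ENNReal.ofReal (L x)) x ∂P := by
  rw [errorSum, withDensity_apply _ hA.compl, lintegral_add_left (measurable_one.indicator hA),
    lintegral_indicator_one hA, lintegral_indicator hA.compl]

theorem errorSum_likelihoodRatio (hL : Measurable L) :
    errorSum P (P.withDensity fun x => ENNReal.ofReal (L x)) {x | 1 < L x} =
      ∫⁻ x, ENNReal.ofReal (min 1 (L x)) ∂P := by
  rw [errorSum_withDensity P (measurableSet_lt measurable_const hL)]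
  refine lintegral_congr fun x => ?_
  by_cases h : 1 < L x
  · simp [h, min_eq_left h.le]
  · simp [h, min_eq_right (not_lt.1 h)]

/-- The likelihood ratio test minimizes the sum of errors. -/
theorem errorSum_likelihoodRatio_le (hL : Measurable L) {A : Set Ω} (hA : MeasurableSet A) :
    errorSum P (P.withDensity fun x => ENNReal.ofReal (L x)) {x | 1 < L x} ≤
      errorSum P (P.withDensity fun x => ENNReal.ofReal (L x)) A := by
  rw [errorSum_likelihoodRatio P hL, errorSum_withDensity P hA]
  refine lintegral_mono fun x => ?_
  by_cases h : x ∈ A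
  · simp [h]
  · simp [h]

theorem minErrorSum_eq (hL : Measurable L) :
    minErrorSum P (P.withDensity fun x => ENNReal.ofReal (L x)) =
      errorSum P (P.withDensity fun x => ENNReal.ofReal (L x)) {x | 1 < L x} :=
  le_antisymm (iInf₂_le _ (measurableSet_lt measurable_const hL))
    (le_iInf₂ fun _ hA => errorSum_likelihoodRatio_le P hL hA)

/-- With u = √l, min 1 l = (1 + u²)/2 - |1 - u|(1 + u)/2, and the product is split by the weighted
AM-GM inequality. Being affine in l and √l, the bound integrates directly to one in the affinity,
without Cauchy–Schwarz; at affinity 1 it equals 1 - η. -/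
theorem sqrt_affine_le_min {η l : ℝ} (hη : 0 < η) (hl : 0 ≤ l) :
    (1 - 1 / (2 * η) - η / 2) * ((1 + l) / 2) + (1 / (2 * η) - η / 2) * √l ≤ min 1 l := by
  set u := √l
  have hu : 0 ≤ u := Real.sqrt_nonneg l
  have hul : l = u ^ 2 := (Real.sq_sqrt hl).symm
  have key : ∀ d : ℝ, d * (1 + u) ≤ d ^ 2 / (2 * η) + η * (1 + u) ^ 2 / 2 := fun d => by
    have : d ^ 2 / (2 * η) + η * (1 + u) ^ 2 / 2 - d * (1 + u) = (d - η * (1 + u)) ^ 2 / (2 * η) := by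
      field_simp
      ring
    have h2 : 0 ≤ (d - η * (1 + u)) ^ 2 / (2 * η) := by positivity
    linarith
  have e : (1 - 1 / (2 * η) - η / 2) * ((1 + l) / 2) + (1 / (2 * η) - η / 2) * u =
      (1 + u ^ 2) / 2 - ((1 - u) ^ 2 / (2 * η) + η * (1 + u) ^ 2 / 2) / 2 := by
    rw [hul]
    field_simp
    ring
  rw [e, hul, le_min_iff]
  constructor
  · have := key (u - 1)
    rw [show (u - 1) ^ 2 = (1 - u) ^ 2 by ring] at this
    linarith
  · nlinarith [key (1 - u)]

/-- A lower bound on the sum of errors in terms of the Hellinger affinity. -/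
theorem le_errorSum_of_affinity [IsProbabilityMeasure P] (hL : Measurable L) (hL0 : ∀ x, 0 ≤ L x)
    [IsProbabilityMeasure (P.withDensity fun x => ENNReal.ofReal (L x))] {η : ℝ} (hη : 0 < η) :
    ENNReal.ofReal (1 - 1 / (2 * η) - η / 2 + (1 / (2 * η) - η / 2) * ∫ x, √(L x) ∂P) ≤
      errorSum P (P.withDensity fun x => ENNReal.ofReal (L x)) {x | 1 < L x} := by
  have h1 : ∫⁻ x, ENNReal.ofReal (L x) ∂P = 1 := by
    rw [← setLIntegral_univ, ← withDensity_apply _ .univ, measure_univ]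
  have hint : Integrable L P := ⟨hL.aestronglyMeasurable, by
    rw [hasFiniteIntegral_iff_ofReal (Eventually.of_forall hL0), h1]
    exact ENNReal.one_lt_top⟩
  have hI : ∫ x, L x ∂P = 1 := by
    rw [integral_eq_lintegral_of_nonneg_ae (Eventually.of_forall hL0) hL.aestronglyMeasurable, h1,
      ENNReal.toReal_one]
  have hsq : Integrable (fun x => √(L x)) P := by
    refine ((integrable_const 1).add hint).mono' hL.sqrt.aestronglyMeasurable
      (Eventually.of_forall fun x => ?_)
    rw [Real.norm_of_nonneg (Real.sqrt_nonneg _), Pi.add_apply]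
    nlinarith [Real.sq_sqrt (hL0 x), sq_nonneg (√(L x) - 1), Real.sqrt_nonneg (L x)]
  have hmin : Integrable (fun x => min 1 (L x)) P := (integrable_const 1).inf hint
  rw [errorSum_likelihoodRatio P hL, ← ofReal_integral_eq_lintegral_ofReal hmin
    (Eventually.of_forall fun x => le_min zero_le_one (hL0 x))]
  refine ENNReal.ofReal_le_ofReal ?_
  have i1 := (((integrable_const (μ := P) (1 : ℝ)).add hint).div_const 2).const_mul
    (1 - 1 / (2 * η) - η / 2)
  have i2 := hsq.const_mul (1 / (2 * η) - η / 2)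
  refine le_trans (le_of_eq ?_) (integral_mono (i1.add i2) hmin
    fun x => sqrt_affine_le_min hη (hL0 x))
  rw [integral_add' i1 i2, integral_const_mul, integral_const_mul, integral_div,
    integral_add' (integrable_const _) hint, hI]
  simp

theorem errorSum_likelihoodRatio_le_one [IsProbabilityMeasure P] (hL : Measurable L) :
    errorSum P (P.withDensity fun x => ENNReal.ofReal (L x)) {x | 1 < L x} ≤ 1 := by
  rw [errorSum_likelihoodRatio P hL]
  refine (lintegral_mono fun x => ENNReal.ofReal_le_ofReal (min_le_left 1 (L x))).trans_eq ?_
  simp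

end LikelihoodRatio

/-! ### The mixture model -/

theorem sparsity_nonneg (β : ℝ) (n : ℕ) : 0 ≤ sparsity β n := Real.rpow_nonneg n.cast_nonneg _

theorem sparsity_le_one {β : ℝ} (hβ : 0 < β) (n : ℕ) : sparsity β n ≤ 1 := by
  rcases n.eq_zero_or_pos with rfl | hn
  · simp [sparsity, Real.zero_rpow (neg_ne_zero.2 hβ.ne')]
  · exact Real.rpow_le_one_of_one_le_of_nonpos (by exact_mod_cast hn) (by linarith)

/-- The likelihood ratio of a single observation. -/
noncomputable def mixtureRatio (γ β r : ℝ) (n : ℕ) (x : ℝ) : ℝ :=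
  ((1 - sparsity β n) * gnDensity γ 0 x +
    sparsity β n * gnDensity γ (amplitude γ r n) x) / gnDensity γ 0 x

section Model

variable {γ β : ℝ} (hγ : 0 < γ) (hβ : 0 < β) (r : ℝ) (n : ℕ)

include hγ in
theorem measurable_mixtureRatio : Measurable (mixtureRatio γ β r n) := by
  have h0 := (continuous_gnDensity hγ 0).measurable
  have h1 := (continuous_gnDensity hγ (amplitude γ r n)).measurable
  unfold mixtureRatio
  fun_prop

include hγ hβ in
theorem mixtureRatio_nonneg (x : ℝ) : 0 ≤ mixtureRatio γ β r n x := by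
  have h0 := gnDensity_pos hγ 0 x
  have h1 := gnDensity_pos hγ (amplitude γ r n) x
  have h2 := sparsity_nonneg β n
  have h3 := sub_nonneg.2 (sparsity_le_one hβ n)
  unfold mixtureRatio
  positivity

include hγ hβ in
theorem mixtureMeasure_eq_withDensity :
    mixtureMeasure γ β r n =
      (gnMeasure γ 0).withDensity fun x => ENNReal.ofReal (mixtureRatio γ β r n x) := by
  have hm : ∀ μ, Measurable fun x => ENNReal.ofReal (gnDensity γ μ x) := fun μ =>
    ENNReal.measurable_ofReal.comp (continuous_gnDensity hγ μ).measurable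
  have hr : Measurable fun x => ENNReal.ofReal (mixtureRatio γ β r n x) :=
    (measurable_mixtureRatio hγ r n).ennreal_ofReal
  rw [mixtureMeasure, gnMeasure, gnMeasure, ← withDensity_mul _ (hm 0) hr,
    ← withDensity_smul _ (hm 0), ← withDensity_smul _ (hm _),
    ← withDensity_add_left ((hm 0).const_smul _)]
  congr 1
  ext1 x
  have h0 := gnDensity_pos hγ 0 x
  have h1 := gnDensity_pos hγ (amplitude γ r n) x
  have h2 := sparsity_nonneg β n
  have h3 := sub_nonneg.2 (sparsity_le_one hβ n)
  simp only [Pi.add_apply, Pi.smul_apply, Pi.mul_apply, smul_eq_mul]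
  rw [← ENNReal.ofReal_mul h3, ← ENNReal.ofReal_mul h2, ← ENNReal.ofReal_mul h0.le,
    ← ENNReal.ofReal_add (by positivity) (by positivity), mixtureRatio,
    mul_div_cancel₀ _ h0.ne']

include hγ hβ in
theorem isProbabilityMeasure_mixtureMeasure : IsProbabilityMeasure (mixtureMeasure γ β r n) := by
  have := isProbabilityMeasure_gnMeasure hγ 0
  have := isProbabilityMeasure_gnMeasure hγ (amplitude γ r n)
  refine ⟨?_⟩
  have h3 := sub_nonneg.2 (sparsity_le_one hβ n)
  simp [mixtureMeasure, ← ENNReal.ofReal_add h3 (sparsity_nonneg β n)]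

include hγ hβ in
theorem mixtureMeasure_real (s : Set ℝ) :
    (mixtureMeasure γ β r n).real s = (1 - sparsity β n) * (gnMeasure γ 0).real s +
      sparsity β n * (gnMeasure γ (amplitude γ r n)).real s := by
  have := isProbabilityMeasure_gnMeasure hγ 0
  have := isProbabilityMeasure_gnMeasure hγ (amplitude γ r n)
  have hne : ∀ (c : ℝ) (μ : Measure ℝ) [IsProbabilityMeasure μ], (ENNReal.ofReal c • μ) s ≠ ∞ :=
    fun c μ _ => by
      rw [Measure.smul_apply, smul_eq_mul]
      exact ENNReal.mul_ne_top ENNReal.ofReal_ne_top (measure_ne_top _ _)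
  rw [mixtureMeasure, measureReal_add_apply (hne _ _) (hne _ _), measureReal_ennreal_smul_apply,
    measureReal_ennreal_smul_apply, ENNReal.toReal_ofReal (sparsity_nonneg β n),
    ENNReal.toReal_ofReal (sub_nonneg.2 (sparsity_le_one hβ n))]

include hγ in
theorem isProbabilityMeasure_nullLaw : IsProbabilityMeasure (nullLaw γ n) := by
  have := isProbabilityMeasure_gnMeasure hγ 0
  unfold nullLaw
  infer_instance

include hγ hβ in
theorem isProbabilityMeasure_altLaw : IsProbabilityMeasure (altLaw γ β r n) := by
  have := isProbabilityMeasure_mixtureMeasure hγ hβ r n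
  unfold altLaw
  infer_instance

theorem likelihoodRatio_eq (x : Fin n → ℝ) :
    likelihoodRatio γ β r n x = ∏ i, mixtureRatio γ β r n (x i) := rfl

include hγ in
theorem measurable_likelihoodRatio : Measurable (likelihoodRatio γ β r n) :=
  Finset.measurable_fun_prod _ fun i _ =>
    (measurable_mixtureRatio hγ r n).comp (measurable_pi_apply i)

include hγ hβ in
theorem altLaw_eq_withDensity :
    altLaw γ β r n =
      (nullLaw γ n).withDensity fun x => ENNReal.ofReal (likelihoodRatio γ β r n x) := by
  have := isProbabilityMeasure_gnMeasure hγ 0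
  have h := isProbabilityMeasure_mixtureMeasure hγ hβ r n
  rw [mixtureMeasure_eq_withDensity hγ hβ] at h
  rw [altLaw, nullLaw, mixtureMeasure_eq_withDensity hγ hβ,
    pi_withDensity _ (measurable_mixtureRatio hγ r n).ennreal_ofReal]
  congr 1
  ext1 x
  rw [likelihoodRatio_eq, ENNReal.ofReal_prod_of_nonneg fun i _ => mixtureRatio_nonneg hγ hβ r n _]

end Model

/-! ### Criteria for separation and merging -/

theorem Separate.of_test {γ β r : ℝ} (hγ : 0 < γ) (hβ : 0 < β) {A : (n : ℕ) → Set (Fin n → ℝ)}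
    (hA : ∀ n, MeasurableSet (A n))
    (h : Tendsto (fun n => errorSum (nullLaw γ n) (altLaw γ β r n) (A n)) atTop (𝓝 0)) :
    Separate γ β r := by
  refine tendsto_of_tendsto_of_tendsto_of_le_of_le tendsto_const_nhds h (fun _ => zero_le)
    fun n => ?_
  simp only [altLaw_eq_withDensity hγ hβ]
  exact errorSum_likelihoodRatio_le _ (measurable_likelihoodRatio hγ r n) (hA n)

/-- The Hellinger affinity of a single observation under the two hypotheses. -/
noncomputable def affinity (γ β r : ℝ) (n : ℕ) : ℝ :=
  ∫ x, √(mixtureRatio γ β r n x) ∂(gnMeasure γ 0)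

theorem integral_sqrt_likelihoodRatio {γ β : ℝ} (hγ : 0 < γ) (hβ : 0 < β) (r : ℝ) (n : ℕ) :
    ∫ x, √(likelihoodRatio γ β r n x) ∂(nullLaw γ n) = affinity γ β r n ^ n := by
  have := isProbabilityMeasure_gnMeasure hγ 0
  simp_rw [likelihoodRatio_eq,
    Real.sqrt_prod Finset.univ fun i _ => mixtureRatio_nonneg hγ hβ r n _]
  rw [nullLaw, integral_fintype_prod_eq_pow fun x => √(mixtureRatio γ β r n x), Fintype.card_fin,
    affinity]

/-- Affinities multiply over independent observations, so Bernoulli's inequality gives a total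
affinity of at least 1 - n R n → 1. The affinity bound then keeps the error sum above 1 - η in the
limit, for every small η. -/
theorem Merge.of_affinity {γ β r : ℝ} (hγ : 0 < γ) (hβ : 0 < β) {R : ℕ → ℝ}
    (hR : Tendsto (fun n : ℕ => n * R n) atTop (𝓝 0))
    (h : ∀ᶠ n in atTop, 1 - R n ≤ affinity γ β r n) : Merge γ β r := by
  have hmain : Tendsto (fun n => errorSum (nullLaw γ n) (altLaw γ β r n) (lrtRegion γ β r n))
      atTop (𝓝 1) := by
    refine tendsto_order.2 ⟨fun c hc => ?_, fun c hc => Eventually.of_forall fun n => ?_⟩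
    · set c' := c.toReal
      have hc' : c' < 1 := by
        rw [← ENNReal.toReal_one]
        exact (ENNReal.toReal_lt_toReal hc.ne_top ENNReal.one_ne_top).2 hc
      have hc0 : 0 ≤ c' := ENNReal.toReal_nonneg
      -- Half the gap, so that the limiting lower bound 1 - η still exceeds c'.
      set η := (1 - c') / 2 with hη
      have hη0 : 0 < η := by linarith
      have hη1 : η ≤ 1 / 2 := by linarith
      have hcoef : 0 ≤ 1 / (2 * η) - η / 2 := by
        have : 1 ≤ 1 / (2 * η) := by rw [le_div_iff₀ (by linarith)]; linarith
        linarith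
      have hlim : Tendsto (fun n : ℕ => 1 - η - (1 / (2 * η) - η / 2) * (n * R n)) atTop
          (𝓝 (1 - η - (1 / (2 * η) - η / 2) * 0)) := (hR.const_mul _).const_sub _
      filter_upwards [hlim.eventually_const_lt (u := c') (by linarith), h] with n hn ha
      have := isProbabilityMeasure_nullLaw hγ n
      have hp := isProbabilityMeasure_altLaw hγ hβ r n
      rw [altLaw_eq_withDensity hγ hβ] at hp ⊢
      refine lt_of_lt_of_le ?_ (le_errorSum_of_affinity _ (measurable_likelihoodRatio hγ r n)
        (fun x => Finset.prod_nonneg fun i _ => mixtureRatio_nonneg hγ hβ r n _) hη0)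
      rw [integral_sqrt_likelihoodRatio hγ hβ, ← ENNReal.ofReal_toReal hc.ne_top]
      refine (ENNReal.ofReal_lt_ofReal_iff_of_nonneg hc0).2 (hn.trans_le ?_)
      have ha0 : 0 ≤ affinity γ β r n := integral_nonneg fun x => Real.sqrt_nonneg _
      have hb := one_add_mul_le_pow (a := affinity γ β r n - 1) (by linarith) n
      rw [add_sub_cancel] at hb
      have hb2 : 1 - n * R n ≤ affinity γ β r n ^ n := by
        have : (n : ℝ) * (1 - affinity γ β r n) ≤ n * R n := by gcongr; linarith
        linarith
      have := mul_le_mul_of_nonneg_left hb2 hcoef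
      linarith
    · have := isProbabilityMeasure_nullLaw hγ n
      refine lt_of_le_of_lt ?_ hc
      rw [altLaw_eq_withDensity hγ hβ]
      exact errorSum_likelihoodRatio_le_one _ (measurable_likelihoodRatio hγ r n)
  refine ⟨hmain, hmain.congr fun n => ?_⟩
  rw [altLaw_eq_withDensity hγ hβ]
  exact (minErrorSum_eq _ (measurable_likelihoodRatio hγ r n)).symm

/-- If the hypotheses merge, then every sequence of tests of vanishing level is powerless. -/
theorem Merge.tendsto_power {γ β r : ℝ} (hγ : 0 < γ) (hβ : 0 < β) (h : Merge γ β r)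
    {A : (n : ℕ) → Set (Fin n → ℝ)}
    (hA : Tendsto (fun n => (nullLaw γ n).real (A n)) atTop (𝓝 0)) :
    Tendsto (fun n => (altLaw γ β r n).real (A n)) atTop (𝓝 0) := by
  have hm : Tendsto (fun n => (minErrorSum (nullLaw γ n) (altLaw γ β r n)).toReal) atTop (𝓝 1) :=
    (ENNReal.tendsto_toReal ENNReal.one_ne_top).comp h.2
  have hup : Tendsto (fun n => (nullLaw γ n).real (A n) +
      (1 - (minErrorSum (nullLaw γ n) (altLaw γ β r n)).toReal)) atTop (𝓝 (0 + (1 - 1))) :=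
    hA.add (hm.const_sub 1)
  rw [sub_self, add_zero] at hup
  refine tendsto_of_tendsto_of_tendsto_of_le_of_le tendsto_const_nhds hup
    (fun n => measureReal_nonneg) fun n => ?_
  have := isProbabilityMeasure_nullLaw hγ n
  have := isProbabilityMeasure_altLaw hγ hβ r n
  -- A n need not be measurable, while `minErrorSum` ranges over measurable tests; the hull keeps
  -- the null probability and can only gain power.
  set B := toMeasurable (nullLaw γ n) (A n)
  have hB : MeasurableSet B := measurableSet_toMeasurable _ _
  have h1 : (altLaw γ β r n).real (A n) ≤ (altLaw γ β r n).real B :=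
    measureReal_mono (subset_toMeasurable _ _)
  have h2 : (nullLaw γ n).real B = (nullLaw γ n).real (A n) := by
    simp [measureReal_def, B, measure_toMeasurable]
  have h3 : (minErrorSum (nullLaw γ n) (altLaw γ β r n)).toReal ≤
      (nullLaw γ n).real B + (altLaw γ β r n).real Bᶜ := by
    rw [measureReal_def, measureReal_def, ← ENNReal.toReal_add (measure_ne_top _ _)
      (measure_ne_top _ _)]
    exact ENNReal.toReal_mono (by simp) (iInf₂_le B hB)
  rw [probReal_compl_eq_one_sub hB] at h3
  simp only
  linarith

/-! ### Merging below the boundary -/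

theorem eventually_scale_le {γ c : ℝ} (hγ : 0 < γ) (hc : 0 < c) :
    ∀ᶠ n : ℕ in atTop, scale γ n ≤ (n : ℝ) ^ c := by
  have h := ((isLittleO_log_rpow_rpow_atTop (1 / γ) hc).comp_tendsto
    tendsto_natCast_atTop_atTop).bound (c := (γ ^ (1 / γ))⁻¹)
    (inv_pos.2 (Real.rpow_pos_of_pos hγ _))
  filter_upwards [h] with n hn
  have hl := Real.log_natCast_nonneg n
  simp only [Function.comp_apply] at hn
  rw [Real.norm_of_nonneg (Real.rpow_nonneg hl _),
    Real.norm_of_nonneg (Real.rpow_nonneg n.cast_nonneg _), inv_mul_eq_div,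
    le_div_iff₀ (Real.rpow_pos_of_pos hγ _)] at hn
  rw [scale, Real.mul_rpow hγ.le hl]
  linarith

/-- With u = √f the difference of the two sides is (u - 1)² u (u + 2)/2. -/
theorem le_sqrt_quadratic {f : ℝ} (hf : 0 ≤ f) : 1 + (f - 1) / 2 - (f - 1) ^ 2 / 2 ≤ √f := by
  set u := √f
  have hu : 0 ≤ u := Real.sqrt_nonneg f
  have hfu : f = u ^ 2 := (Real.sq_sqrt hf).symm
  rw [hfu]
  nlinarith [mul_nonneg (sq_nonneg (u - 1)) hu, mul_nonneg (sq_nonneg (u - 1)) (mul_nonneg hu hu)]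

/-- The left-hand side is min 1 f. -/
theorem le_sqrt_abs {f : ℝ} (hf : 0 ≤ f) : 1 + (f - 1) / 2 - |f - 1| / 2 ≤ √f := by
  rcases le_total f 1 with h | h
  · rw [abs_of_nonpos (by linarith)]
    have := (Real.le_sqrt hf hf).2 (show f ^ 2 ≤ f by nlinarith)
    linarith
  · rw [abs_of_nonneg (by linarith)]
    have := Real.one_le_sqrt.2 h
    linarith

section SqrtMixture

variable {a b ε : ℝ} (ha : 0 < a) (hb : 0 < b) (hε : 0 ≤ ε) (hε1 : ε ≤ 1)

include ha hb hε hε1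

/-- Here f - 1 = ε(b - a)/a, and (b - a)²/a is at most a + b²/a. The b²/a term is the chi-square
density, useful only where it is under control. -/
theorem le_mul_sqrt_mixture_quadratic :
    a + ε * (b - a) / 2 - ε ^ 2 * (a + b ^ 2 / a) / 2 ≤ a * √(((1 - ε) * a + ε * b) / a) := by
  have h3 := sub_nonneg.2 hε1
  have h := mul_le_mul_of_nonneg_left
    (le_sqrt_quadratic (f := ((1 - ε) * a + ε * b) / a) (by positivity)) ha.le
  refine le_trans ?_ h
  have e : a * (1 + (((1 - ε) * a + ε * b) / a - 1) / 2 -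
      (((1 - ε) * a + ε * b) / a - 1) ^ 2 / 2) =
      a + ε * (b - a) / 2 - ε ^ 2 * (a + b ^ 2 / a) / 2 + ε ^ 2 * b := by
    field_simp
    ring
  rw [e]
  have : 0 ≤ ε ^ 2 * b := by positivity
  linarith

/-- First-order substitute for the far tail, where b²/a may be too large. -/
theorem le_mul_sqrt_mixture_linear :
    a + ε * (b - a) / 2 - ε * (a + b) / 2 ≤ a * √(((1 - ε) * a + ε * b) / a) := by
  have h3 := sub_nonneg.2 hε1
  have h := mul_le_mul_of_nonneg_left
    (le_sqrt_abs (f := ((1 - ε) * a + ε * b) / a) (by positivity)) ha.le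
  refine le_trans ?_ h
  have e : ((1 - ε) * a + ε * b) / a - 1 = ε * (b - a) / a := by
    field_simp
    ring
  rw [e]
  have h4 : a * |ε * (b - a) / a| = ε * |b - a| := by
    rw [abs_div, abs_mul, abs_of_nonneg hε, abs_of_pos ha, mul_div_cancel₀ _ ha.ne']
  have h5 : a * (ε * (b - a) / a) = ε * (b - a) := mul_div_cancel₀ _ ha.ne'
  have h6 : ε * |b - a| ≤ ε * (a + b) :=
    mul_le_mul_of_nonneg_left (abs_le.2 ⟨by linarith, by linarith⟩) hε
  linarith

end SqrtMixture

theorem gnDensity_sq_div {γ : ℝ} (hγ : 0 < γ) (μ x : ℝ) :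
    gnDensity γ μ x ^ 2 / gnDensity γ 0 x =
      (gnConst γ)⁻¹ * Real.exp (-(2 * (|x - μ| ^ γ / γ) - |x| ^ γ / γ)) := by
  have hC := (gnConst_pos hγ).ne'
  have e : -(2 * (|x - μ| ^ γ / γ) - |x| ^ γ / γ) =
    -(|x - μ| ^ γ / γ) + -(|x - μ| ^ γ / γ) - -(|x| ^ γ / γ) := by ring
  rw [gnDensity, gnDensity, sub_zero, e, Real.exp_sub, Real.exp_add]
  field_simp

theorem Merge.of_exponent_neg {γ β r : ℝ} (hγ : 0 < γ) (hβ : 1 / 2 < β) (hr : 0 < r) (hr1 : r < 1)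
    (hG : ∀ s ∈ Set.Icc (0 : ℝ) 1, s ^ γ / 2 + 1 / 2 - β - |s - r ^ (1 / γ)| ^ γ < 0) :
    Merge γ β r := by
  have hβ0 : 0 < β := by linarith
  have hC := gnConst_pos hγ
  set ρ := r ^ (1 / γ) with hρ
  have hρ0 : 0 < ρ := Real.rpow_pos_of_pos hr _
  have hρ1 : ρ < 1 := Real.rpow_lt_one hr.le hr1 (one_div_pos.2 hγ)
  -- Compactness of [0, 1] makes the negativity uniform.
  obtain ⟨δ, hδ, hGδ⟩ : ∃ δ > 0, ∀ s ∈ Set.Icc (0 : ℝ) 1,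
      s ^ γ / 2 + 1 / 2 - β - |s - ρ| ^ γ ≤ -δ := by
    have h1 : Continuous fun s : ℝ => s ^ γ := Real.continuous_rpow_const hγ.le
    have h2 : Continuous fun s : ℝ => |s - ρ| ^ γ :=
      h1.comp (continuous_abs.comp (continuous_id.sub continuous_const))
    have hc : Continuous fun s : ℝ => s ^ γ / 2 + 1 / 2 - β - |s - ρ| ^ γ := by fun_prop
    obtain ⟨s₀, hs₀, hmax⟩ := isCompact_Icc.exists_isMaxOn (Set.nonempty_Icc.2 zero_le_one)
      hc.continuousOn
    exact ⟨-(s₀ ^ γ / 2 + 1 / 2 - β - |s₀ - ρ| ^ γ), by linarith [hG s₀ hs₀],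
      fun s hs => (hmax hs).trans_eq (by ring)⟩
  -- Bound for g₁²/g₀ on (0, l]: at x = sl this ratio is n^(s^γ - 2|s - ρ|^γ) / C_γ. In D below, the
  -- three terms are the contributions of the null density, of (0, l] and of (l, ∞).
  set K : ℕ → ℝ := fun n => (gnConst γ)⁻¹ * (n : ℝ) ^ (2 * β - 1 - 2 * δ) with hK
  set D : ℕ → ℝ := fun n => sparsity β n ^ 2 + sparsity β n ^ 2 * K n * scale γ n / 2 +
    sparsity β n * (pValue γ (scale γ n * 1) + pValue γ (scale γ n * (1 - ρ))) / 2 with hD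
  refine Merge.of_affinity hγ hβ0 (R := D) ?_ ?_
  · have hlim : Tendsto (fun n : ℕ => (n : ℝ) ^ (-(2 * β - 1)) +
        (gnConst γ)⁻¹ / 2 * (n : ℝ) ^ (-δ) + (n : ℝ) ^ (-(δ / 2))) atTop (𝓝 0) := by
      simpa using ((tendsto_natCast_rpow_neg (by linarith : 0 < 2 * β - 1)).add
        ((tendsto_natCast_rpow_neg hδ).const_mul _)).add (tendsto_natCast_rpow_neg (half_pos hδ))
    refine tendsto_of_tendsto_of_tendsto_of_le_of_le' tendsto_const_nhds hlim
      (Eventually.of_forall fun n => ?_) ?_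
    · have h1 := sparsity_nonneg β n
      have h2 := scale_nonneg hγ n
      have h3 := pValue_pos hγ (scale γ n * 1)
      have h4 := pValue_pos hγ (scale γ n * (1 - ρ))
      positivity
    · filter_upwards [eventually_scale_le hγ hδ, eventually_gt_atTop 0,
        eventually_pValue_le hγ (sub_pos.2 hρ1) (half_pos hδ)] with n hn hn0 hp
      have h0 : (0 : ℝ) < n := by exact_mod_cast hn0
      have h1 : (1 : ℝ) ≤ n := by exact_mod_cast hn0
      have hpp : pValue γ (scale γ n * 1) ≤ pValue γ (scale γ n * (1 - ρ)) :=
        pValue_antitone hγ (mul_le_mul_of_nonneg_left (by linarith) (scale_nonneg hγ n))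
      have e1 : (n : ℝ) * sparsity β n ^ 2 = (n : ℝ) ^ (-(2 * β - 1)) := by
        rw [sparsity, ← Real.rpow_natCast, ← Real.rpow_mul h0.le, ← Real.rpow_one_add' h0.le]
        · congr 1; push_cast; ring
        · push_cast; linarith
      have e2 : (n : ℝ) * (sparsity β n ^ 2 * K n * scale γ n / 2) ≤
          (gnConst γ)⁻¹ / 2 * (n : ℝ) ^ (-δ) := by
        calc (n : ℝ) * (sparsity β n ^ 2 * K n * scale γ n / 2)
            = (gnConst γ)⁻¹ / 2 * ((n : ℝ) ^ (-(2 * β - 1)) * (n : ℝ) ^ (2 * β - 1 - 2 * δ) *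
              scale γ n) := by rw [← e1, hK]; ring
          _ ≤ (gnConst γ)⁻¹ / 2 * ((n : ℝ) ^ (-(2 * β - 1)) * (n : ℝ) ^ (2 * β - 1 - 2 * δ) *
              (n : ℝ) ^ δ) := by gcongr
          _ = _ := by
            rw [← Real.rpow_add h0, ← Real.rpow_add h0]
            ring_nf
      have e3 : (n : ℝ) * (sparsity β n * (pValue γ (scale γ n * 1) +
          pValue γ (scale γ n * (1 - ρ))) / 2) ≤ (n : ℝ) ^ (-(δ / 2)) := by
        have hn1 : 0 ≤ (n : ℝ) * sparsity β n := mul_nonneg h0.le (sparsity_nonneg β n)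
        calc _ = n * sparsity β n * ((pValue γ (scale γ n * 1) +
              pValue γ (scale γ n * (1 - ρ))) / 2) := by ring
          _ ≤ n * sparsity β n * (n : ℝ) ^ (-(1 - ρ) ^ γ + δ / 2) :=
              mul_le_mul_of_nonneg_left (by linarith) hn1
          _ = (n : ℝ) ^ (1 + -β + (-(1 - ρ) ^ γ + δ / 2)) := by
              rw [Real.rpow_add h0 (1 + -β), Real.rpow_add h0 1, Real.rpow_one, sparsity]
          _ ≤ _ := by
              refine Real.rpow_le_rpow_of_exponent_le h1 ?_
              -- At s = 1 the exponent is 1 - β - (1 - ρ)^γ, exactly that of the expected number of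
              -- signals beyond l.
              have := hGδ 1 (by simp)
              rw [abs_of_pos (sub_pos.2 hρ1), Real.one_rpow] at this
              linarith
      calc (n : ℝ) * D n = n * sparsity β n ^ 2 + n * (sparsity β n ^ 2 * K n * scale γ n / 2) +
            n * (sparsity β n * (pValue γ (scale γ n * 1) +
              pValue γ (scale γ n * (1 - ρ))) / 2) := by rw [hD]; ring
        _ ≤ _ := add_le_add (add_le_add e1.le e2) e3
  · filter_upwards [eventually_gt_atTop 1] with n hn1
    have h0 : 0 < n := by omega
    set ε := sparsity β n
    have hε : 0 ≤ ε := sparsity_nonneg β n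
    have hε1 : ε ≤ 1 := sparsity_le_one hβ0 n
    set l := scale γ n with hl_def
    have hl : 0 < l := Real.rpow_pos_of_pos
      (mul_pos hγ (Real.log_pos (by exact_mod_cast hn1))) _
    have hμ : amplitude γ r n = l * ρ := amplitude_eq hγ hr.le n
    set g₀ := gnDensity γ 0
    set g₁ := gnDensity γ (amplitude γ r n)
    have hg₀ : ∀ x, 0 < g₀ x := gnDensity_pos hγ 0
    have hg₁ : ∀ x, 0 < g₁ x := gnDensity_pos hγ _
    have ig₀ : Integrable g₀ := integrable_gnDensity hγ 0
    have ig₁ : Integrable g₁ := integrable_gnDensity hγ _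
    set R₁ : ℝ → ℝ := (Set.Ioc 0 l).indicator fun _ => ε ^ 2 * K n
    set R₂ : ℝ → ℝ := (Set.Ioi l).indicator fun x => ε * (g₀ x + g₁ x)
    have iR₁ : Integrable R₁ := (integrableOn_const (by simp)).integrable_indicator measurableSet_Ioc
    have iR₂ : Integrable R₂ :=
      ((ig₀.add ig₁).const_mul ε).integrableOn.integrable_indicator measurableSet_Ioi
    have hK0 : 0 ≤ K n := by positivity
    have hR₁ : ∀ x, 0 ≤ R₁ x := fun x => Set.indicator_nonneg (fun _ _ => by positivity) x
    have hR₂ : ∀ x, 0 ≤ R₂ x := fun x => Set.indicator_nonneg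
      (fun x _ => mul_nonneg hε (add_pos (hg₀ x) (hg₁ x)).le) x
    -- For x ≤ 0 the signal density is below the null one, so g₁²/g₀ ≤ g₀; on (0, l] it is at most K
    -- n; beyond l the linear bound is used.
    have hpt : ∀ x, g₀ x + ε * (g₁ x - g₀ x) / 2 - (2 * ε ^ 2 * g₀ x + R₁ x + R₂ x) / 2 ≤
        g₀ x * √(mixtureRatio γ β r n x) := fun x => by
      rcases le_or_gt x 0 with hx | hx
      · refine le_trans ?_ (le_mul_sqrt_mixture_quadratic (hg₀ x) (hg₁ x) hε hε1)
        have hle : g₁ x ≤ g₀ x := by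
          refine mul_le_mul_of_nonneg_left (Real.exp_le_exp.2 ?_) (by positivity)
          have h1 : |x| ^ γ ≤ |x - amplitude γ r n| ^ γ := by
            refine Real.rpow_le_rpow (abs_nonneg _) ?_ hγ.le
            have : 0 < l * ρ := by positivity
            rw [hμ, abs_of_nonpos hx, abs_of_nonpos (by linarith)]
            linarith
          rw [sub_zero]
          gcongr
        have h2 : g₁ x ^ 2 / g₀ x ≤ g₀ x := by
          rw [div_le_iff₀ (hg₀ x)]
          nlinarith [hg₀ x, hg₁ x]
        have := mul_le_mul_of_nonneg_left h2 (sq_nonneg ε)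
        linarith [hR₁ x, hR₂ x]
      · rcases le_or_gt x l with hxl | hxl
        · refine le_trans ?_ (le_mul_sqrt_mixture_quadratic (hg₀ x) (hg₁ x) hε hε1)
          have h2 : g₁ x ^ 2 / g₀ x ≤ K n := by
            have hxs : x = l * (x / l) := by field_simp
            have hs0 : 0 ≤ x / l := by positivity
            have hs1 : x / l ≤ 1 := (div_le_one hl).2 hxl
            have ea : |x - amplitude γ r n| = l * |x / l - ρ| := by
              rw [hμ, ← abs_of_pos hl, ← abs_mul, abs_of_pos hl, mul_sub, ← hxs]
            have eb : |x| ^ γ / γ = (x / l) ^ γ * Real.log n := by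
              rw [abs_of_pos hx, ← scale_mul_rpow_div hγ hs0, ← hl_def, ← hxs]
            have h3 : gnDensity γ (amplitude γ r n) x ^ 2 / gnDensity γ 0 x ≤ K n := by
              rw [gnDensity_sq_div hγ, ea, scale_mul_rpow_div hγ (abs_nonneg _), eb,
                ← mul_assoc, ← sub_mul, exp_neg_mul_log h0]
              refine mul_le_mul_of_nonneg_left (Real.rpow_le_rpow_of_exponent_le
                (by exact_mod_cast h0) ?_) (by positivity)
              linarith [hGδ (x / l) ⟨hs0, hs1⟩]
            exact h3
          have h4 : R₁ x = ε ^ 2 * K n := Set.indicator_of_mem (Set.mem_Ioc.2 ⟨hx, hxl⟩) _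
          have h5 := mul_le_mul_of_nonneg_left h2 (sq_nonneg ε)
          have h6 : 0 ≤ ε ^ 2 * g₀ x := mul_nonneg (sq_nonneg ε) (hg₀ x).le
          linarith [hR₂ x]
        · refine le_trans ?_ (le_mul_sqrt_mixture_linear (hg₀ x) (hg₁ x) hε hε1)
          have h4 : R₂ x = ε * (g₀ x + g₁ x) := Set.indicator_of_mem (Set.mem_Ioi.2 hxl) _
          have h6 : 0 ≤ ε ^ 2 * g₀ x := mul_nonneg (sq_nonneg ε) (hg₀ x).le
          linarith [hR₁ x]
    have haff : affinity γ β r n = ∫ x, g₀ x * √(mixtureRatio γ β r n x) := by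
      rw [affinity, gnMeasure, integral_withDensity_eq_integral_toReal_smul
        (continuous_gnDensity hγ 0).measurable.ennreal_ofReal (by simp)]
      simp only [ENNReal.toReal_ofReal (gnDensity_pos hγ 0 _).le, smul_eq_mul]
      rfl
    have hR₁int : ∫ x, R₁ x = ε ^ 2 * K n * l := by
      rw [integral_indicator_const _ measurableSet_Ioc, measureReal_def, Real.volume_Ioc,
        ENNReal.toReal_ofReal (by linarith), smul_eq_mul]
      ring
    have hR₂int : ∫ x, R₂ x = ε * (pValue γ (l * 1) + pValue γ (l * (1 - ρ))) := by
      have e1 := gnMeasure_real_Ioi hγ 0 l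
      have e2 := gnMeasure_real_Ioi hγ (amplitude γ r n) l
      rw [gnMeasure_real hγ _ measurableSet_Ioi] at e1 e2
      rw [integral_indicator measurableSet_Ioi, integral_const_mul,
        integral_add ig₀.integrableOn ig₁.integrableOn, e1, e2, hμ]
      ring_nf
    have hsqrt : Integrable fun x => g₀ x * √(mixtureRatio γ β r n x) := by
      refine (ig₀.add (ig₁.const_mul ε)).mono' (by
          have h1 := (continuous_gnDensity hγ 0).measurable
          have h2 := (measurable_mixtureRatio (β := β) hγ r n).sqrt
          exact (h1.mul h2).aestronglyMeasurable) (Eventually.of_forall fun x => ?_)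
      have hf := mixtureRatio_nonneg hγ hβ0 r n x
      rw [Real.norm_of_nonneg (mul_nonneg (hg₀ x).le (Real.sqrt_nonneg _))]
      have h1 : √(mixtureRatio γ β r n x) ≤ (1 + mixtureRatio γ β r n x) / 2 := by
        nlinarith [Real.sq_sqrt hf, sq_nonneg (√(mixtureRatio γ β r n x) - 1)]
      have h2 : g₀ x * mixtureRatio γ β r n x = (1 - ε) * g₀ x + ε * g₁ x :=
        mul_div_cancel₀ _ (hg₀ x).ne'
      have h3 := mul_le_mul_of_nonneg_left h1 (hg₀ x).le
      simp only [Pi.add_apply]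
      nlinarith [hg₀ x, hg₁ x, mul_nonneg hε (hg₀ x).le, mul_nonneg hε (hg₁ x).le]
    have i1 : Integrable fun x => ε * (g₁ x - g₀ x) / 2 := ((ig₁.sub ig₀).const_mul ε).div_const 2
    have i2 : Integrable fun x => 2 * ε ^ 2 * g₀ x := ig₀.const_mul _
    have i12 : Integrable fun x => 2 * ε ^ 2 * g₀ x + R₁ x := i2.add iR₁
    have i3 : Integrable fun x => (2 * ε ^ 2 * g₀ x + R₁ x + R₂ x) / 2 :=
      (i12.add iR₂).div_const 2
    -- The first-order term integrates to zero, both densities having mass 1; only D n is lost.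
    have hle := integral_mono ((ig₀.add i1).sub i3) hsqrt hpt
    rw [haff]
    refine le_trans (le_of_eq ?_) hle
    rw [integral_sub' (ig₀.add i1) i3, integral_add' ig₀ i1, integral_div, integral_const_mul,
      integral_sub ig₁ ig₀, integral_div, integral_add i12 iR₂, integral_add i2 iR₁,
      integral_const_mul, hR₁int, hR₂int, integral_gnDensity hγ, integral_gnDensity hγ]
    simp only [hD]
    ring

/-! ### Detection above the boundary by counting exceedances -/

/-- Rejects when the number of observations above `t` exceeds its null mean by `log n` null
standard deviations. -/
def exceedanceRegion (γ : ℝ) (n : ℕ) (t : ℝ) : Set (Fin n → ℝ) :=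
  {x | n * pValue γ t + √(n * pValue γ t) * Real.log n < count (Set.Ioi t) x}

theorem measurableSet_exceedanceRegion (γ : ℝ) (n : ℕ) (t : ℝ) :
    MeasurableSet (exceedanceRegion γ n t) :=
  measurableSet_lt measurable_const (measurable_count measurableSet_Ioi)

theorem nullLaw_exceedanceRegion_le {γ : ℝ} (hγ : 0 < γ) {n : ℕ} (hn : 1 < n) (t : ℝ) :
    (nullLaw γ n).real (exceedanceRegion γ n t) ≤ (Real.log n ^ 2)⁻¹ := by
  have := isProbabilityMeasure_gnMeasure hγ 0
  have := isProbabilityMeasure_nullLaw hγ n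
  have hp := pValue_pos hγ t
  have hn0 : (0 : ℝ) < n := by exact_mod_cast (by omega : 0 < n)
  have hl : 0 < Real.log n := Real.log_pos (by exact_mod_cast hn)
  have hs : 0 < √(n * pValue γ t) := Real.sqrt_pos.2 (by positivity)
  have h := measure_count_sub_ge (gnMeasure γ 0) n (measurableSet_Ioi (a := t)) (mul_pos hs hl)
  refine (measureReal_mono (fun x hx => ?_)).trans (h.trans_eq ?_)
  · have hx : n * pValue γ t + √(n * pValue γ t) * Real.log n < count (Set.Ioi t) x := hx
    refine le_trans ?_ (le_abs_self ((count (Set.Ioi t) x : ℝ) - n * pValue γ t))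
    linarith
  · rw [mul_pow, Real.sq_sqrt (by positivity)]
    change n * pValue γ t / _ = _
    field_simp

section Detection

variable {γ β r s : ℝ}

/-- W = n ε p₁, the expected number of signals above the threshold, beats log n null standard
deviations by a power of n because G(s) > 0. The null mass displaced by the mixture is negligible
because (s - ρ)^γ < s^γ. W itself grows like a power because s < 1. -/
theorem eventually_signal_dominates (hγ : 0 < γ) (hρ0 : 0 < r ^ (1 / γ)) (hs : r ^ (1 / γ) < s)
    (hs1 : s < 1) (hG : 0 < s ^ γ / 2 + 1 / 2 - β - (s - r ^ (1 / γ)) ^ γ) :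
    ∃ δ : ℝ, 0 < δ ∧ ∀ᶠ n : ℕ in atTop,
      pValue γ (scale γ n * s) ≤ pValue γ (scale γ n * (s - r ^ (1 / γ))) / 4 ∧
      √(n * pValue γ (scale γ n * s)) * Real.log n ≤
        n * sparsity β n * pValue γ (scale γ n * (s - r ^ (1 / γ))) * (n : ℝ) ^ (-δ) ∧
      (n : ℝ) ^ δ ≤ n * sparsity β n * pValue γ (scale γ n * (s - r ^ (1 / γ))) := by
  set ρ := r ^ (1 / γ)
  have hs0 : 0 < s := hρ0.trans hs
  set q := s ^ γ
  set e := (s - ρ) ^ γ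
  have hq1 : q ≤ 1 := Real.rpow_le_one hs0.le hs1.le hγ.le
  have hqe : e < q := Real.rpow_lt_rpow (by linarith) (by linarith) hγ
  -- An eighth leaves room for all the n^δ losses below.
  set δ := min (q / 2 + 1 / 2 - β - e) (q - e) / 8 with hδ_def
  have hδ : 0 < δ := div_pos (lt_min hG (by linarith)) (by norm_num)
  have hδ1 : 8 * δ ≤ q / 2 + 1 / 2 - β - e := by
    have := min_le_left (q / 2 + 1 / 2 - β - e) (q - e)
    linarith
  have hδ2 : 8 * δ ≤ q - e := by
    have := min_le_right (q / 2 + 1 / 2 - β - e) (q - e)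
    linarith
  have hlog : ∀ᶠ n : ℕ in atTop, Real.log n ≤ (n : ℝ) ^ δ := by
    filter_upwards [((isLittleO_log_rpow_atTop hδ).comp_tendsto
      tendsto_natCast_atTop_atTop).bound one_pos] with n hn
    simp only [Function.comp_apply, one_mul] at hn
    exact (Real.le_norm_self _).trans
      (hn.trans_eq (Real.norm_of_nonneg (Real.rpow_nonneg n.cast_nonneg _)))
  refine ⟨δ, hδ, ?_⟩
  filter_upwards [hlog, eventually_pValue_le hγ hs0 hδ, eventually_le_pValue hγ (sub_pos.2 hs) hδ,
    eventually_le_natCast_rpow 4 hδ, eventually_gt_atTop 0] with n hn1 hn2 hn3 hn4 hn5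
  have h0 : (0 : ℝ) < n := by exact_mod_cast hn5
  have h1 : (1 : ℝ) ≤ n := by exact_mod_cast hn5
  have hp := pValue_pos hγ (scale γ n * s)
  have hW : (n : ℝ) ^ (1 - β - e - δ) ≤ n * sparsity β n * pValue γ (scale γ n * (s - ρ)) := by
    calc (n : ℝ) ^ (1 - β - e - δ) = n * sparsity β n * (n : ℝ) ^ (-e - δ) := by
          rw [sparsity, show 1 - β - e - δ = 1 + -β + (-e - δ) by ring, Real.rpow_add h0 (1 + -β),
            Real.rpow_add h0 1, Real.rpow_one]
      _ ≤ _ := mul_le_mul_of_nonneg_left hn3 (mul_nonneg h0.le (sparsity_nonneg β n))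
  refine ⟨?_, ?_, ?_⟩
  · have : 4 * (n : ℝ) ^ (-q + δ) ≤ (n : ℝ) ^ (-e - δ) :=
      calc 4 * (n : ℝ) ^ (-q + δ) ≤ (n : ℝ) ^ δ * (n : ℝ) ^ (-q + δ) := by gcongr
        _ = (n : ℝ) ^ (δ + (-q + δ)) := (Real.rpow_add h0 _ _).symm
        _ ≤ _ := Real.rpow_le_rpow_of_exponent_le h1 (by linarith)
    linarith
  · have hsq : √(n * pValue γ (scale γ n * s)) ≤ (n : ℝ) ^ ((1 - q + δ) / 2) := by
      refine Real.sqrt_le_iff.2 ⟨by positivity, ?_⟩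
      calc n * pValue γ (scale γ n * s) ≤ n * (n : ℝ) ^ (-q + δ) := by gcongr
        _ = (n : ℝ) ^ (1 + (-q + δ)) := by rw [Real.rpow_add h0 1, Real.rpow_one]
        _ = _ := by
            rw [← Real.rpow_natCast, ← Real.rpow_mul h0.le]
            congr 1
            push_cast
            ring
    calc √(n * pValue γ (scale γ n * s)) * Real.log n
        ≤ (n : ℝ) ^ ((1 - q + δ) / 2) * (n : ℝ) ^ δ :=
          mul_le_mul hsq hn1 (Real.log_natCast_nonneg n) (by positivity)
      _ = (n : ℝ) ^ ((1 - q + δ) / 2 + δ) := (Real.rpow_add h0 _ _).symm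
      _ ≤ (n : ℝ) ^ (1 - β - e - δ + -δ) := Real.rpow_le_rpow_of_exponent_le h1 (by linarith)
      _ = (n : ℝ) ^ (1 - β - e - δ) * (n : ℝ) ^ (-δ) := Real.rpow_add h0 _ _
      _ ≤ _ := by gcongr
  · exact (Real.rpow_le_rpow_of_exponent_le h1 (by linarith)).trans hW

theorem mixtureMeasure_real_Ioi_scale (hγ : 0 < γ) (hβ : 0 < β) (hr : 0 ≤ r) (n : ℕ) :
    (mixtureMeasure γ β r n).real (Set.Ioi (scale γ n * s)) =
      (1 - sparsity β n) * pValue γ (scale γ n * s) +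
        sparsity β n * pValue γ (scale γ n * (s - r ^ (1 / γ))) := by
  rw [mixtureMeasure_real hγ hβ, gnMeasure_real_Ioi hγ, gnMeasure_real_Ioi hγ, sub_zero,
    amplitude_eq hγ hr, ← mul_sub]

/-- The mean count under the mixture lies at least W/4 above the threshold and its variance is at
most 2 W² n^(-δ), so Chebyshev's inequality gives 32 n^(-δ). -/
theorem tendsto_altLaw_compl_exceedanceRegion (hγ : 0 < γ) (hβ : 0 < β) (hr : 0 < r)
    (hs : r ^ (1 / γ) < s) (hs1 : s < 1)
    (hG : 0 < s ^ γ / 2 + 1 / 2 - β - (s - r ^ (1 / γ)) ^ γ) :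
    Tendsto (fun n => (altLaw γ β r n).real (exceedanceRegion γ n (scale γ n * s))ᶜ)
      atTop (𝓝 0) := by
  obtain ⟨δ, hδ, hev⟩ := eventually_signal_dominates hγ (Real.rpow_pos_of_pos hr _) hs hs1 hG
  have hlim : Tendsto (fun n : ℕ => 32 * (n : ℝ) ^ (-δ)) atTop (𝓝 0) := by
    simpa using (tendsto_natCast_rpow_neg hδ).const_mul 32
  have hlog : ∀ᶠ n : ℕ in atTop, 1 ≤ Real.log n :=
    (Real.tendsto_log_atTop.comp tendsto_natCast_atTop_atTop).eventually_ge_atTop 1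
  refine tendsto_of_tendsto_of_tendsto_of_le_of_le' tendsto_const_nhds hlim
    (Eventually.of_forall fun n => measureReal_nonneg) ?_
  filter_upwards [hev, eventually_gt_atTop 0, eventually_le_natCast_rpow 4 hδ, hlog]
    with n ⟨h1, h2, h3⟩ hn hn4 hl
  have := isProbabilityMeasure_mixtureMeasure hγ hβ r n
  have := isProbabilityMeasure_altLaw hγ hβ r n
  have hn0 : (0 : ℝ) < n := by exact_mod_cast hn
  have hε := sparsity_nonneg β n
  have hε1 := sparsity_le_one hβ n
  have hm := mixtureMeasure_real_Ioi_scale (s := s) hγ hβ hr.le n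
  set p := pValue γ (scale γ n * s) with hp_def
  set p₁ := pValue γ (scale γ n * (s - r ^ (1 / γ)))
  set ε := sparsity β n
  set m := (mixtureMeasure γ β r n).real (Set.Ioi (scale γ n * s))
  have hp : 0 < p := pValue_pos hγ _
  set W := n * ε * p₁ with hW_def
  set u := (n : ℝ) ^ (-δ) with hu_def
  have hu0 : 0 < u := Real.rpow_pos_of_pos hn0 _
  have huinv : (n : ℝ) ^ δ = u⁻¹ := by rw [hu_def, Real.rpow_neg hn0.le, inv_inv]
  rw [huinv] at h3 hn4
  have hu4 : u ≤ 1 / 4 := by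
    rw [le_inv_comm₀ (by norm_num) hu0] at hn4
    linarith
  have hW : 0 < W := (inv_pos.2 hu0).trans_le h3
  have hWu : 1 ≤ W * u := by
    rwa [inv_le_iff_one_le_mul₀ hu0] at h3
  have hnm : n * m - n * p ≥ 3 / 4 * W := by
    have : n * ε * p ≤ n * ε * (p₁ / 4) := by gcongr
    rw [hm, hW_def]
    linarith
  have hdev : W / 4 ≤ n * m - (n * p + √(n * p) * Real.log n) := by nlinarith
  have hnm' : n * m ≤ 2 * W ^ 2 * u := by
    have a1 : n * p ≤ (W * u) ^ 2 := by
      calc n * p = √(n * p) ^ 2 := (Real.sq_sqrt (by positivity)).symm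
        _ ≤ (√(n * p) * Real.log n) ^ 2 := by
            gcongr
            exact le_mul_of_one_le_right (Real.sqrt_nonneg _) hl
        _ ≤ _ := by gcongr
    have a2 : n * m ≤ n * p + W := by
      have : 0 ≤ n * ε * p := by positivity
      rw [hm, hW_def]
      linarith
    have a3 : (W * u) ^ 2 ≤ W ^ 2 * u := by
      have : u ^ 2 ≤ u := by nlinarith
      rw [mul_pow]
      gcongr
    nlinarith
  have hcheb := measure_count_sub_ge (mixtureMeasure γ β r n) n
    (measurableSet_Ioi (a := scale γ n * s)) (c := W / 4) (by positivity)
  refine (measureReal_mono (fun x hx => ?_)).trans (hcheb.trans ?_)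
  · have hx : ¬ (n * p + √(n * p) * Real.log n < count (Set.Ioi (scale γ n * s)) x) := hx
    refine le_trans ?_ (neg_le_abs ((count (Set.Ioi (scale γ n * s)) x : ℝ) - n * m))
    linarith
  · rw [div_le_iff₀ (by positivity)]
    exact hnm'.trans_eq (by ring)

theorem Separate.of_exponent_pos (hγ : 0 < γ) (hβ : 0 < β) (hr : 0 < r)
    (hs : r ^ (1 / γ) < s) (hs1 : s < 1)
    (hG : 0 < s ^ γ / 2 + 1 / 2 - β - (s - r ^ (1 / γ)) ^ γ) : Separate γ β r := by
  refine Separate.of_test hγ hβ (fun n => measurableSet_exceedanceRegion γ n (scale γ n * s)) ?_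
  have h0 : Tendsto (fun n => (nullLaw γ n).real (exceedanceRegion γ n (scale γ n * s)))
      atTop (𝓝 0) := by
    have hlim : Tendsto (fun n : ℕ => (Real.log n ^ 2)⁻¹) atTop (𝓝 0) :=
      ((tendsto_pow_atTop two_ne_zero).comp
        (Real.tendsto_log_atTop.comp tendsto_natCast_atTop_atTop)).inv_tendsto_atTop
    refine tendsto_of_tendsto_of_tendsto_of_le_of_le' tendsto_const_nhds hlim
      (Eventually.of_forall fun n => measureReal_nonneg) ?_
    filter_upwards [eventually_gt_atTop 1] with n hn
    exact nullLaw_exceedanceRegion_le hγ hn _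
  have h1 := tendsto_altLaw_compl_exceedanceRegion hγ hβ hr hs hs1 hG
  have h := ENNReal.tendsto_ofReal (h0.add h1)
  rw [add_zero, ENNReal.ofReal_zero] at h
  refine h.congr fun n => ?_
  have := isProbabilityMeasure_nullLaw hγ n
  have := isProbabilityMeasure_altLaw hγ hβ r n
  rw [ENNReal.ofReal_add measureReal_nonneg measureReal_nonneg, ofReal_measureReal,
    ofReal_measureReal, errorSum]

end Detection

/-! ### Higher criticism -/

theorem monotone_sorted {n : ℕ} (p : Fin n → ℝ) : Monotone (sorted p) := Tuple.monotone_sort p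

theorem sorted_le_of_lt_card {n : ℕ} (p : Fin n → ℝ) {c : ℝ} {k : Fin n}
    (hk : (k : ℕ) < (Finset.univ.filter fun i => p i ≤ c).card) : sorted p k ≤ c := by
  have e : (Finset.univ.filter fun i => sorted p i ≤ c).card =
      (Finset.univ.filter fun i => p i ≤ c).card :=
    Finset.card_equiv (Tuple.sort p) fun i => by
      rw [Finset.mem_filter_univ, Finset.mem_filter_univ, sorted, Function.comp_apply]
  exact (Tuple.lt_card_le_iff_apply_le_of_monotone (monotone_sorted p)).1 (hk.trans_eq e.symm)

theorem sorted_pValue_pos {γ : ℝ} (hγ : 0 < γ) {n : ℕ} (x : Fin n → ℝ) (k : Fin n) :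
    0 < sorted (fun i => pValue γ (x i)) k := pValue_pos hγ _

theorem sorted_pValue_lt_one {γ : ℝ} (hγ : 0 < γ) {n : ℕ} (x : Fin n → ℝ) (k : Fin n) :
    sorted (fun i => pValue γ (x i)) k < 1 := pValue_lt_one hγ _

/-- If N observations exceed t, the N-th smallest p-value is at most `pValue γ t`, so the term i = N
of the maximum exceeds log n. The bound on N keeps this index within the range of the maximum. -/
theorem mem_hcRegion_of_mem_exceedanceRegion {γ α₀ : ℝ} (hγ : 0 < γ) {n : ℕ} {t h : ℝ}
    (hh : h ≤ Real.log n) {x : Fin n → ℝ} (hx : x ∈ exceedanceRegion γ n t)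
    (hα : (count (Set.Ioi t) x : ℝ) ≤ α₀ * n) : x ∈ hcRegion γ α₀ n h := by
  classical
  set N := count (Set.Ioi t) x
  have hx : n * pValue γ t + √(n * pValue γ t) * Real.log n < N := hx
  have hπ := pValue_pos hγ t
  have hl := Real.log_natCast_nonneg n
  have hN0 : 0 < N := by
    have : (0 : ℝ) < N := lt_of_le_of_lt (by positivity) hx
    exact_mod_cast this
  have hNn : N ≤ n := (Finset.card_le_univ _).trans_eq (Fintype.card_fin n)
  have hn : (0 : ℝ) < n := by exact_mod_cast hN0.trans_le hNn
  -- Indices start at 0, so the N-th order statistic has index N - 1.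
  let k : Fin n := ⟨N - 1, by omega⟩
  have hkN : ((k : ℕ) + 1 : ℝ) = N := by
    have : (k : ℕ) + 1 = N := Nat.sub_add_cancel hN0
    exact_mod_cast this
  set p := sorted fun i => pValue γ (x i)
  have hpk : p k ≤ pValue γ t := by
    refine sorted_le_of_lt_card _ (lt_of_lt_of_le (Nat.sub_lt hN0 one_pos) ?_)
    change (Finset.univ.filter fun i => x i ∈ Set.Ioi t).card ≤ _
    exact Finset.card_le_card fun i => by
      simpa using fun hi : t < x i => pValue_antitone hγ hi.le
  have hp0 : 0 < p k := sorted_pValue_pos hγ x k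
  have hp1 : p k < 1 := sorted_pValue_lt_one hγ x k
  have hpp : 0 < p k * (1 - p k) := mul_pos hp0 (sub_pos.2 hp1)
  refine (hh.trans_lt ?_).trans_le (le_ciSup (Set.finite_range _).bddAbove ⟨k, hkN.trans_le hα⟩)
  change Real.log n < √n * (((k : ℕ) + 1 : ℝ) / n - p k) / √(p k * (1 - p k))
  rw [lt_div_iff₀ (Real.sqrt_pos.2 hpp), hkN]
  have hsn : 0 < √(n : ℝ) := Real.sqrt_pos.2 hn
  calc Real.log n * √(p k * (1 - p k)) ≤ Real.log n * √(pValue γ t) := by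
        gcongr
        nlinarith
    _ < √n * (N / n - pValue γ t) := by
        rw [Real.sqrt_mul hn.le] at hx
        have h2 : (n : ℝ) = √n * √n := (Real.mul_self_sqrt hn.le).symm
        have h3 : √n * (N / n - pValue γ t) = (N - n * pValue γ t) / √n := by
          field_simp
          rw [Real.sq_sqrt hn.le]
        rw [h3, lt_div_iff₀ hsn]
        linarith
    _ ≤ _ := by gcongr

theorem IsSlowCriticalSeq.eventually_le_log {γ α₀ : ℝ} {α h : ℕ → ℝ}
    (hh : IsSlowCriticalSeq γ α₀ α h) : ∀ᶠ n : ℕ in atTop, h n ≤ Real.log n := by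
  have hlog : ∀ᶠ n : ℕ in atTop, 8 ≤ Real.log n :=
    (Real.tendsto_log_atTop.comp tendsto_natCast_atTop_atTop).eventually_ge_atTop 8
  filter_upwards [hh.slow.eventually_le_const (u := 2) (by norm_num), hlog] with n hn hl
  have h1 : 0 < Real.log (Real.log n) := Real.log_pos (by linarith)
  rw [div_le_iff₀ (Real.sqrt_pos.2 (by linarith))] at hn
  refine hn.trans ?_
  have h2 : √(2 * Real.log (Real.log n)) ≤ Real.log n / 2 := by
    refine Real.sqrt_le_iff.2 ⟨by linarith, ?_⟩
    have := Real.log_le_sub_one_of_pos (show 0 < Real.log n by linarith)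
    nlinarith
  linarith

theorem IsSlowCriticalSeq.tendsto_power {γ α₀ β r s : ℝ} (hγ : 0 < γ) (hα₀ : 0 < α₀) (hβ : 0 < β)
    (hr : 0 < r) (hs : r ^ (1 / γ) < s) (hs1 : s < 1)
    (hG : 0 < s ^ γ / 2 + 1 / 2 - β - (s - r ^ (1 / γ)) ^ γ) {α h : ℕ → ℝ}
    (hh : IsSlowCriticalSeq γ α₀ α h) :
    Tendsto (fun n => (altLaw γ β r n).real (hcRegion γ α₀ n (h n))) atTop (𝓝 1) := by
  have hs0 : 0 < s := (Real.rpow_pos_of_pos hr _).trans hs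
  have hq := Real.rpow_pos_of_pos hs0 γ
  have hA := tendsto_altLaw_compl_exceedanceRegion hγ hβ hr hs hs1 hG
  have hε : Tendsto (fun n : ℕ => ((n : ℝ) ^ (-(s ^ γ / 2)) + (n : ℝ) ^ (-β)) / α₀)
      atTop (𝓝 0) := by
    simpa using ((tendsto_natCast_rpow_neg (half_pos hq)).add
      (tendsto_natCast_rpow_neg hβ)).div_const α₀
  have hlim := (hA.add hε).const_sub 1
  rw [add_zero, sub_zero] at hlim
  have hprob := isProbabilityMeasure_altLaw hγ hβ r
  refine tendsto_of_tendsto_of_tendsto_of_le_of_le' hlim tendsto_const_nhds ?_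
    (Eventually.of_forall fun n => measureReal_le_one)
  filter_upwards [hh.eventually_le_log, eventually_pValue_le hγ hs0 (half_pos hq),
    eventually_gt_atTop 0] with n hn hp hn0
  have hn0' : (0 : ℝ) < n := by exact_mod_cast hn0
  have := isProbabilityMeasure_mixtureMeasure hγ hβ r n
  set t := scale γ n * s
  set A := exceedanceRegion γ n t
  -- The exceptional event that the useful index falls outside i ≤ α₀ n; Markov's inequality makes
  -- it negligible since the tail mass at t tends to 0.
  set B : Set (Fin n → ℝ) := {x | α₀ * n < count (Set.Ioi t) x}
  have hmA : MeasurableSet A := measurableSet_exceedanceRegion γ n t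
  have hmB : MeasurableSet B := measurableSet_lt measurable_const (measurable_count measurableSet_Ioi)
  have hB : (altLaw γ β r n).real B ≤ ((n : ℝ) ^ (-(s ^ γ / 2)) + (n : ℝ) ^ (-β)) / α₀ := by
    refine (measure_count_gt (mixtureMeasure γ β r n) n (measurableSet_Ioi (a := t))
      (by positivity)).trans ?_
    rw [mixtureMeasure_real_Ioi_scale hγ hβ hr.le, mul_comm α₀, mul_div_mul_left _ _ hn0'.ne']
    have hε0 := sparsity_nonneg β n
    have hp0 := pValue_pos hγ t
    have hp1 := pValue_lt_one hγ (scale γ n * (s - r ^ (1 / γ)))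
    gcongr
    · rw [neg_add_eq_sub, show s ^ γ / 2 - s ^ γ = -(s ^ γ / 2) by ring] at hp
      refine le_trans ?_ hp
      nlinarith
    · exact mul_le_of_le_one_right hε0 hp1.le
  have hsub : A \ B ⊆ hcRegion γ α₀ n (h n) := fun x hx =>
    mem_hcRegion_of_mem_exceedanceRegion hγ hn hx.1 (not_lt.1 hx.2)
  have h1 : (altLaw γ β r n).real (A \ B)ᶜ ≤ (altLaw γ β r n).real Aᶜ + (altLaw γ β r n).real B := by
    rw [Set.sdiff_eq, Set.compl_inter, compl_compl]
    exact measureReal_union_le _ _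
  rw [probReal_compl_eq_one_sub (hmA.diff hmB)] at h1
  have h2 : (altLaw γ β r n).real (A \ B) ≤ (altLaw γ β r n).real (hcRegion γ α₀ n (h n)) :=
    measureReal_mono hsub
  linarith

/-! ### The function `ρ*_γ` -/

/-- Weighted convexity of `x ^ γ`. -/
theorem rpow_le_weighted {γ x a b l : ℝ} (hγ : 1 ≤ γ) (hx : 0 ≤ x) (ha : 0 ≤ a) (hb : 0 ≤ b)
    (hl : 0 < l) (hl1 : l < 1) (h : x ≤ a + b) :
    x ^ γ ≤ l ^ (1 - γ) * a ^ γ + (1 - l) ^ (1 - γ) * b ^ γ := by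
  have hl' : 0 < 1 - l := sub_pos.2 hl1
  have hc := (convexOn_rpow hγ).2 (Set.mem_Ici.2 (div_nonneg ha hl.le))
    (Set.mem_Ici.2 (div_nonneg hb hl'.le)) hl.le hl'.le (add_sub_cancel _ _)
  simp only [smul_eq_mul] at hc
  rw [mul_div_cancel₀ _ hl.ne', mul_div_cancel₀ _ hl'.ne', Real.div_rpow ha hl.le,
    Real.div_rpow hb hl'.le] at hc
  have e : ∀ {c d : ℝ}, 0 < c → c * (d / c ^ γ) = c ^ (1 - γ) * d := fun hc0 => by
    rw [Real.rpow_sub hc0, Real.rpow_one]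
    ring
  rw [e hl, e hl'] at hc
  exact (Real.rpow_le_rpow hx h (by linarith)).trans hc

section Exponents

variable {γ β r : ℝ}

/-- The constant `c = 2^(1/(γ-1))` and its powers that occur in `ρ*_γ`. -/
theorem two_rpow_facts (hγ : 1 < γ) :
    1 < (2 : ℝ) ^ (1 / (γ - 1)) ∧ ((2 : ℝ) ^ (1 / (γ - 1))) ^ (γ - 1) = 2 ∧
      (2 : ℝ) ^ (-(γ / (γ - 1))) = ((2 : ℝ) ^ (1 / (γ - 1))) ^ (-γ) := by
  have h : 0 < γ - 1 := sub_pos.2 hγ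
  refine ⟨Real.one_lt_rpow (by norm_num) (one_div_pos.2 h), ?_, ?_⟩
  · rw [← Real.rpow_mul (by norm_num), one_div_mul_cancel h.ne', Real.rpow_one]
  · rw [← Real.rpow_mul (by norm_num)]
    ring_nf

/-- The two branches of `rhoStar` agree at the break point β = 1 - c^(-γ), where both equal (1 -
1/c)^γ. -/
theorem rpow_div_eq (c : ℝ) (hc : 1 < c) (hc2 : c ^ (γ - 1) = 2) :
    (c - 1) ^ (γ - 1) * ((1 : ℝ) / 2 - c ^ (-γ)) = (1 - 1 / c) ^ γ := by
  have hc0 : 0 < c := by linarith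
  have h1 : c ^ γ = 2 * c := by
    rw [← hc2, ← Real.rpow_add_one hc0.ne', sub_add_cancel]
  have h2 : (c - 1) ^ γ = (c - 1) ^ (γ - 1) * (c - 1) := by
    rw [← Real.rpow_add_one (by linarith : c - 1 ≠ 0), sub_add_cancel]
  rw [show 1 - 1 / c = (c - 1) / c by field_simp, Real.div_rpow (by linarith) hc0.le,
    Real.rpow_neg hc0.le, h1, h2]
  field_simp

theorem rhoStar_mem_Ioo (hγ : 0 < γ) (hβ : β ∈ Set.Ioo (1 / 2 : ℝ) 1) :
    rhoStar γ β ∈ Set.Ioo (0 : ℝ) 1 := by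
  obtain ⟨hβ1, hβ2⟩ := hβ
  unfold rhoStar
  split_ifs with h1 h2
  · obtain ⟨hc, hc2, hcγ⟩ := two_rpow_facts h1
    set c := (2 : ℝ) ^ (1 / (γ - 1))
    have hp : 0 < (c - 1) ^ (γ - 1) := Real.rpow_pos_of_pos (by linarith) _
    refine ⟨mul_pos hp (by linarith), ?_⟩
    have h3 := rpow_div_eq c hc hc2
    rw [hcγ] at h2
    have h4 : (1 - 1 / c) ^ γ < 1 := by
      have : 0 < 1 / c := by positivity
      have : 1 / c < 1 := (div_lt_one (by linarith)).2 hc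
      exact Real.rpow_lt_one (by linarith) (by linarith) hγ
    refine lt_of_le_of_lt ?_ (h3.trans_lt h4)
    exact mul_le_mul_of_nonneg_left (by linarith) hp.le
  · have h3 : 0 < (1 - β) ^ (1 / γ) := Real.rpow_pos_of_pos (by linarith) _
    have h4 : (1 - β) ^ (1 / γ) < 1 :=
      Real.rpow_lt_one (by linarith) (by linarith) (one_div_pos.2 hγ)
    exact ⟨Real.rpow_pos_of_pos (by linarith) _,
      Real.rpow_lt_one (by linarith) (by linarith) hγ⟩
  · constructor <;> linarith

/-- Convexity is applied with weight l = 1/c, chosen so that l^(1 - γ) = 2 cancels the factor 1/2.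
Equality holds at s = ρ/(1 - 1/c), the unconstrained maximizer. -/
theorem half_rpow_sub_le (c : ℝ) (hγ : 1 < γ) (hc : 1 < c) (hc2 : c ^ (γ - 1) = 2) {s ρ : ℝ}
    (hs : 0 ≤ s) (hρ : 0 ≤ ρ) :
    s ^ γ / 2 - |s - ρ| ^ γ ≤ ρ ^ γ / (c - 1) ^ (γ - 1) := by
  have hc0 : 0 < c := by linarith
  have h := rpow_le_weighted hγ.le hs (abs_nonneg (s - ρ)) hρ (one_div_pos.2 hc0)
    ((div_lt_one hc0).2 hc) (by linarith [le_abs_self (s - ρ)])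
  have e1 : (1 / c) ^ (1 - γ) = 2 := by
    rw [one_div, Real.inv_rpow hc0.le, ← Real.rpow_neg hc0.le, neg_sub, hc2]
  have e2 : (1 - 1 / c) ^ (1 - γ) = 2 / (c - 1) ^ (γ - 1) := by
    rw [show 1 - 1 / c = (c / (c - 1))⁻¹ by field_simp, Real.inv_rpow (by
      have : 0 < c - 1 := by linarith
      positivity), ← Real.rpow_neg (by
      have : 0 < c - 1 := by linarith
      positivity), neg_sub, Real.div_rpow hc0.le (by linarith), hc2]
  rw [e1, e2] at h
  have : 2 / (c - 1) ^ (γ - 1) * ρ ^ γ = 2 * (ρ ^ γ / (c - 1) ^ (γ - 1)) := by ring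
  linarith

/-- For `r < ρ*_γ(β)` the detection exponent is negative at every threshold. -/
theorem exponent_neg_of_lt_rhoStar (hγ : 0 < γ) (hβ : β ∈ Set.Ioo (1 / 2 : ℝ) 1) (hr : 0 < r)
    (hr1 : r < 1) (h : r < rhoStar γ β) {s : ℝ} (hs : s ∈ Set.Icc (0 : ℝ) 1) :
    s ^ γ / 2 + 1 / 2 - β - |s - r ^ (1 / γ)| ^ γ < 0 := by
  obtain ⟨hβ1, hβ2⟩ := hβ
  set ρ := r ^ (1 / γ) with hρ_def
  have hρ : 0 < ρ := Real.rpow_pos_of_pos hr _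
  have hρ1 : ρ < 1 := Real.rpow_lt_one hr.le hr1 (one_div_pos.2 hγ)
  have hργ : ρ ^ γ = r := by
    rw [hρ_def, ← Real.rpow_mul hr.le, one_div_mul_cancel hγ.ne', Real.rpow_one]
  have habs : s ≤ |s - ρ| + ρ := by linarith [le_abs_self (s - ρ)]
  have habs0 : 0 ≤ |s - ρ| ^ γ := Real.rpow_nonneg (abs_nonneg _) _
  unfold rhoStar at h
  split_ifs at h with h1 h2
  · obtain ⟨hc, hc2, hcγ⟩ := two_rpow_facts h1
    set c := (2 : ℝ) ^ (1 / (γ - 1))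
    have hk : 0 < (c - 1) ^ (γ - 1) := Real.rpow_pos_of_pos (by linarith) _
    have h3 := half_rpow_sub_le c h1 hc hc2 hs.1 hρ.le
    rw [mul_comm, ← div_lt_iff₀ hk] at h
    rw [hργ] at h3
    linarith
  · obtain ⟨hc, hc2, hcγ⟩ := two_rpow_facts h1
    set c := (2 : ℝ) ^ (1 / (γ - 1))
    have hc0 : 0 < c := by linarith
    have hk : 0 < (c - 1) ^ (γ - 1) := Real.rpow_pos_of_pos (by linarith) _
    rw [hcγ, not_le] at h2
    have h1c : 1 / c < 1 := (div_lt_one hc0).2 hc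
    -- For ρ ≤ 1 - 1/c the unconstrained maximum is at most 1/2 - c^(-γ), which is below β - 1/2.
    -- Otherwise the maximizer lies beyond 1, and weight 1 - ρ puts the equality case at s = 1.
    rcases le_or_gt ρ (1 - 1 / c) with h3 | h3
    · have h4 := half_rpow_sub_le c h1 hc hc2 hs.1 hρ.le
      have h5 : ρ ^ γ / (c - 1) ^ (γ - 1) ≤ 1 / 2 - c ^ (-γ) := by
        rw [div_le_iff₀ hk, mul_comm, rpow_div_eq c hc hc2]
        exact Real.rpow_le_rpow hρ.le h3 hγ.le
      linarith
    · have hρ' : 0 < 1 - ρ := sub_pos.2 hρ1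
      have h4 := rpow_le_weighted h1.le hs.1 (abs_nonneg (s - ρ)) hρ.le hρ' (by linarith) habs
      rw [sub_sub_cancel, ← Real.rpow_add hρ, sub_add_cancel, Real.rpow_one] at h4
      set K := (1 - ρ) ^ (1 - γ) with hK
      have hK2 : 2 ≤ K := by
        have e1 : (1 / c) ^ (1 - γ) = 2 := by
          rw [one_div, Real.inv_rpow hc0.le, ← Real.rpow_neg hc0.le, neg_sub, hc2]
        rw [← e1]
        exact Real.rpow_le_rpow_of_nonpos hρ' (by linarith) (by linarith)
      have h5 : 1 - β < (1 - ρ) ^ γ := by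
        have hlt : (1 - β) ^ (1 / γ) < 1 - ρ := by
          rw [← hργ] at h
          have := (Real.rpow_lt_rpow_iff hρ.le (by
            have := Real.rpow_le_one (by linarith : 0 ≤ 1 - β) (by linarith) (one_div_pos.2 hγ).le
            linarith) hγ).1 h
          linarith
        have := Real.rpow_lt_rpow (Real.rpow_nonneg (by linarith) _) hlt hγ
        rwa [← Real.rpow_mul (by linarith), one_div_mul_cancel hγ.ne', Real.rpow_one] at this
      have h6 : K * (1 - ρ) ^ γ = 1 - ρ := by
        rw [hK, ← Real.rpow_add hρ', sub_add_cancel, Real.rpow_one]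
      have h7 : s ^ γ ≤ 1 := Real.rpow_le_one hs.1 hs.2 hγ.le
      by_contra! hcon
      -- Since K ≥ 2 and s^γ ≤ 1, K·G(s) is at most K(1 - β) - (1 - ρ), which is negative by `h5`
      -- and `h6`.
      nlinarith [mul_lt_mul_of_pos_left h5 (by linarith : 0 < K),
        mul_nonneg (by linarith : 0 ≤ K) hcon,
        mul_nonneg (by linarith : 0 ≤ K - 2) (by linarith : 0 ≤ 1 - s ^ γ)]
  · have h2 : s ^ γ ≤ |s - ρ| ^ γ + ρ ^ γ :=
      (Real.rpow_le_rpow hs.1 habs hγ.le).trans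
        (Real.rpow_add_le_add_rpow (abs_nonneg _) hρ.le hγ.le (not_lt.1 h1))
    linarith

/-- Moving the signal from ρ₀ up to ρ brings it closer to s₀ and makes the exponent there positive;
if it overtakes s₀, the threshold s = ρ works instead. -/
theorem exists_exponent_pos_of_critical (hγ : 0 < γ) {ρ₀ s₀ ρ : ℝ} (hs₀ : s₀ ≤ 1) (hρs : ρ₀ < s₀)
    (hρ₀ : 0 < ρ₀) (h : s₀ ^ γ / 2 + 1 / 2 - β - (s₀ - ρ₀) ^ γ = 0) (hρ : ρ₀ < ρ) (hρ1 : ρ < 1) :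
    ∃ s ∈ Set.Icc ρ 1, 0 < s ^ γ / 2 + 1 / 2 - β - |s - ρ| ^ γ := by
  have hpos : 0 < (s₀ - ρ₀) ^ γ := Real.rpow_pos_of_pos (by linarith) _
  rcases le_total s₀ ρ with hle | hle
  · refine ⟨ρ, ⟨le_rfl, hρ1.le⟩, ?_⟩
    have : s₀ ^ γ ≤ ρ ^ γ := Real.rpow_le_rpow (by linarith) hle hγ.le
    rw [sub_self, abs_zero, Real.zero_rpow hγ.ne']
    linarith
  · refine ⟨s₀, ⟨hle, hs₀⟩, ?_⟩
    rw [abs_of_nonneg (by linarith)]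
    have : (s₀ - ρ) ^ γ < (s₀ - ρ₀) ^ γ := Real.rpow_lt_rpow (by linarith) (by linarith) hγ
    linarith

/-- For `r > ρ*_γ(β)` the detection exponent is positive at some threshold. -/
theorem exists_exponent_pos_of_rhoStar_lt (hγ : 0 < γ) (hβ : β ∈ Set.Ioo (1 / 2 : ℝ) 1)
    (hr1 : r < 1) (h : rhoStar γ β < r) :
    ∃ s, r ^ (1 / γ) < s ∧ s < 1 ∧ 0 < s ^ γ / 2 + 1 / 2 - β - (s - r ^ (1 / γ)) ^ γ := by
  have hρs := (rhoStar_mem_Ioo hγ hβ).1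
  have hr : 0 < r := hρs.trans h
  set ρ := r ^ (1 / γ) with hρ_def
  have hρ : 0 < ρ := Real.rpow_pos_of_pos hr _
  have hρ1 : ρ < 1 := Real.rpow_lt_one hr.le hr1 (one_div_pos.2 hγ)
  have hργ : ρ ^ γ = r := by
    rw [hρ_def, ← Real.rpow_mul hr.le, one_div_mul_cancel hγ.ne', Real.rpow_one]
  have hρ₀ : rhoStar γ β ^ (1 / γ) < ρ := Real.rpow_lt_rpow hρs.le h (one_div_pos.2 hγ)
  have hρ₀0 : 0 < rhoStar γ β ^ (1 / γ) := Real.rpow_pos_of_pos hρs _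
  have hρ₀γ : (rhoStar γ β ^ (1 / γ)) ^ γ = rhoStar γ β := by
    rw [← Real.rpow_mul hρs.le, one_div_mul_cancel hγ.ne', Real.rpow_one]
  obtain ⟨s, hs, hG⟩ : ∃ s ∈ Set.Icc ρ 1, 0 < s ^ γ / 2 + 1 / 2 - β - |s - ρ| ^ γ := by
    obtain ⟨hβ1, hβ2⟩ := hβ
    by_cases h1 : 1 < γ
    · obtain ⟨hc, hc2, hcγ⟩ := two_rpow_facts h1
      set c := (2 : ℝ) ^ (1 / (γ - 1)) with hc_def
      have hc0 : 0 < c := by linarith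
      have hc' : 0 < 1 - 1 / c := sub_pos.2 ((div_lt_one hc0).2 hc)
      have hk : 0 < (c - 1) ^ (γ - 1) := Real.rpow_pos_of_pos (by linarith) _
      have hkc := rpow_div_eq c hc hc2
      by_cases h2 : β ≤ 1 - 2 ^ (-(γ / (γ - 1)))
      · have hval : rhoStar γ β = (c - 1) ^ (γ - 1) * (β - 1 / 2) := by
          rw [rhoStar, if_pos h1, if_pos h2]
        rw [hcγ] at h2
        set ρ₀ := rhoStar γ β ^ (1 / γ)
        -- The equality case of `half_rpow_sub_le`; it is at most 1 exactly on this branch.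
        refine exists_exponent_pos_of_critical hγ (s₀ := ρ₀ / (1 - 1 / c)) ?_ ?_ hρ₀0 ?_ hρ₀ hρ1
        · rw [div_le_one hc', ← Real.rpow_le_rpow_iff hρ₀0.le hc'.le hγ, hρ₀γ, ← hkc, hval]
          exact mul_le_mul_of_nonneg_left (by linarith) hk.le
        · rw [lt_div_iff₀ hc']
          exact mul_lt_of_lt_one_right hρ₀0 (by linarith [one_div_pos.2 hc0])
        · have e1 : ρ₀ / (1 - 1 / c) - ρ₀ = ρ₀ / (1 - 1 / c) / c := by
            have : c - 1 ≠ 0 := by linarith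
            field_simp
            ring
          have hne : 1 / 2 - c ^ (-γ) ≠ 0 := fun h0 => by
            rw [h0, mul_zero] at hkc
            exact (Real.rpow_pos_of_pos hc' γ).ne hkc
          rw [e1, Real.div_rpow (by positivity) hc0.le, Real.div_rpow hρ₀0.le hc'.le, hρ₀γ, ← hkc,
            hval]
          rw [Real.rpow_neg hc0.le] at hne ⊢
          have : 0 < c ^ γ := Real.rpow_pos_of_pos hc0 γ
          have e2 : ∀ x y : ℝ, x / 2 - x / y = x * (1 / 2 - y⁻¹) := fun x y => by ring
          rw [show ∀ x y : ℝ, x / 2 + 1 / 2 - β - x / y = x / 2 - x / y + 1 / 2 - β from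
            fun x y => by ring, e2, mul_div_mul_left _ _ hk.ne', div_mul_cancel₀ _ hne]
          ring
      · have hval : rhoStar γ β = (1 - (1 - β) ^ (1 / γ)) ^ γ := by
          rw [rhoStar, if_pos h1, if_neg h2]
        have hb0 : 0 < (1 - β) ^ (1 / γ) := Real.rpow_pos_of_pos (by linarith) _
        have hb1 : (1 - β) ^ (1 / γ) < 1 :=
          Real.rpow_lt_one (by linarith) (by linarith) (one_div_pos.2 hγ)
        have e1 : rhoStar γ β ^ (1 / γ) = 1 - (1 - β) ^ (1 / γ) := by
          rw [hval, ← Real.rpow_mul (by linarith), mul_one_div_cancel hγ.ne', Real.rpow_one]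
        rw [e1] at hρ₀
        refine exists_exponent_pos_of_critical hγ (s₀ := 1) le_rfl (by linarith) (by linarith) ?_
          hρ₀ hρ1
        rw [sub_sub_cancel, ← Real.rpow_mul (by linarith), one_div_mul_cancel hγ.ne', Real.rpow_one,
          Real.one_rpow]
        ring
    · refine ⟨ρ, ⟨le_rfl, hρ1.le⟩, ?_⟩
      rw [rhoStar, if_neg h1] at h
      rw [sub_self, abs_zero, Real.zero_rpow hγ.ne', hργ]
      linarith
  -- The threshold found may be an endpoint; positivity is an open condition, so it moves into (ρ,
  -- 1).
  have h1 : Continuous fun s : ℝ => s ^ γ := Real.continuous_rpow_const hγ.le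
  have h2 : Continuous fun s : ℝ => |s - ρ| ^ γ :=
    h1.comp (continuous_abs.comp (continuous_id.sub continuous_const))
  have ho : IsOpen {s : ℝ | 0 < s ^ γ / 2 + 1 / 2 - β - |s - ρ| ^ γ} :=
    isOpen_lt continuous_const (by fun_prop)
  rw [← closure_Ioo hρ1.ne] at hs
  obtain ⟨s', hs', hs'1, hs'2⟩ := mem_closure_iff.1 hs _ ho hG
  refine ⟨s', hs'1, hs'2, ?_⟩
  have hs' : 0 < s' ^ γ / 2 + 1 / 2 - β - |s' - ρ| ^ γ := hs'
  rwa [abs_of_pos (sub_pos.2 hs'1)] at hs'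

end Exponents

/-! ### The two boundary theorems -/

theorem isOptimalBoundary_rhoStar {γ : ℝ} (hγ : 0 < γ) : IsOptimalBoundary γ (rhoStar γ) := by
  refine fun β hβ => ⟨rhoStar_mem_Ioo hγ hβ, fun r hr => ⟨fun h => ?_, fun h => ?_⟩⟩
  · obtain ⟨s, hs, hs1, hG⟩ := exists_exponent_pos_of_rhoStar_lt hγ hβ hr.2 h
    exact Separate.of_exponent_pos hγ (by linarith [hβ.1]) hr.1 hs hs1 hG
  · exact Merge.of_exponent_neg hγ hβ.1 hr.1 hr.2 fun s hs =>
      exponent_neg_of_lt_rhoStar hγ hβ hr.1 hr.2 h hs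

/-- The size of h n matters only above the boundary; below it, the vanishing level together with
merging suffices. -/
theorem isHCBoundary_rhoStar {γ α₀ : ℝ} (hγ : 0 < γ) (hα₀ : 0 < α₀) :
    IsHCBoundary γ α₀ (rhoStar γ) := by
  refine fun β hβ => ⟨rhoStar_mem_Ioo hγ hβ, fun r hr α h hh => ⟨fun hlt => ?_, fun hlt => ?_⟩⟩
  · obtain ⟨s, hs, hs1, hG⟩ := exists_exponent_pos_of_rhoStar_lt hγ hβ hr.2 hlt
    exact hh.tendsto_power hγ hα₀ (by linarith [hβ.1]) hr.1 hs hs1 hG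
  · have hM := ((isOptimalBoundary_rhoStar hγ β hβ).2 r hr).2 hlt
    refine hM.tendsto_power hγ (by linarith [hβ.1]) ?_
    exact tendsto_of_tendsto_of_tendsto_of_le_of_le tendsto_const_nhds hh.level_tendsto
      (fun n => measureReal_nonneg) hh.level_le

end HigherCriticism

/-- For every shape `γ > 0` and every range `0 < α₀ < 1` of the higher criticism statistic, the
function `ρ*_γ` is the optimal detection boundary, and it is also the detection boundary of
higher criticism. -/
theorem theorem5p1 (γ : ℝ) (hγ : 0 < γ) (α₀ : ℝ) (hα₀ : 0 < α₀) (hα₁ : α₀ < 1) :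
    HigherCriticism.IsOptimalBoundary γ (HigherCriticism.rhoStar γ) ∧
      HigherCriticism.IsHCBoundary γ α₀ (HigherCriticism.rhoStar γ) := 
  ⟨HigherCriticism.isOptimalBoundary_rhoStar hγ, HigherCriticism.isHCBoundary_rhoStar hγ hα₀⟩
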